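/- Let $q\ge 2$ be an integer and let $\mathfrak X$ be the $(q+1)$-regular tree. For $n\in\mathbb N$ let $\Gamma_n$ be a group of automorphisms of $\mathfrak X$ whose non-trivial elements fix no vertex, such that the quotient graph $G_n=\Gamma_n\backslash\mathfrak X$ (loops and multiple edges are allowed) has a finite vertex set $V_n=\Gamma_n\backslash V(\mathfrak X)$, and assume $|V_n|\to\infty$. Let $d$ be the graph distance of $G_n$, and let $\mathcal A$ be the adjacency operator on $\ell^2(V_n)$ (counting measure), that is, the restriction of $\mathcal A f(x)=\sum_{y\sim x}f(y)$ on $\mathfrak X$ to $\Gamma_n$-invariant functions, viewed as functions on $V_n$. Assume: (EXP) There is $\beta>0$ such that for all $n$ the spectrum of $(q+1)^{-1}\mathcal A$ on $\ell^2(V_n)$ is contained in $\{1\}\cup[-1+\beta,1-\beta]$. (BST) For all $R$, $|\{x\in V_n:\rho(x)<R\}|/|V_n|\to 0$ as $n\to\infty$, where $\rho(x)$ is the largest $r$ such that the ball $B(x,r)$ in $G_n$ is a tree. Let $(\psi^{(n)}_j)_{1\le j\le |V_n|}$ be an orthonormal basis of $\ell^2(V_n)$ with $\mathcal A\psi^{(n)}_j=\lambda^{(n)}_j\psi^{(n)}_j$.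 Fix $D\in\mathbb N$, and let $\mathbf K_n$ be operators on $\ell^2(V_n)$ whose kernels $K_n(x,y)=\langle\delta_x,\mathbf K_n\delta_y\rangle$ satisfy $K_n(x,y)=0$ whenever $d(x,y)>D$ and $|K_n(x,y)|\le 1$ for all $n$ and all $x,y\in V_n$. Then $$\frac1{|V_n|}\sum_{j=1}^{|V_n|}\left|\langle\psi^{(n)}_j,\mathbf K_n\psi^{(n)}_j\rangle-\langle\mathbf K_n\rangle_{\lambda^{(n)}_j}\right|^2\longrightarrow 0\qquad(n\to\infty),$$ where $$\langle\mathbf K_n\rangle_\lambda=\frac1{|V_n|}\sum_{x,y\in V_n}K_n(x,y)\,\Phi_\lambda(d(x,y)),$$ $$\Phi_\lambda(d)=q^{-d/2}\left(\frac{2}{q+1}\cos(d\,s\ln q)+\frac{q-1}{q+1}\,\frac{\sin((d+1)s\ln q)}{\sin(s\ln q)}\right),$$ and $s\in\mathbb C$ is any number with $\lambda=2\sqrt q\cos(s\ln q)$; the last quotient is extended by continuity to the zeros of $\sin(s\ln q)$, and $\Phi_\lambda(d)$ does not depend on the choice of $s$. -/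

import Mathlib

open Filter Topology

namespace QuantumErgodicity

noncomputable section

/-! ### Quotients of a tree by a group of automorphisms

`T` is a simple graph on `X` (in the theorem, the `(q+1)`-regular tree) and `Γ` is a group of
automorphisms of `T`.  The quotient `G = Γ \ T` may have loops and multiple edges. -/

section Quotient

variable {X : Type*} {T : SimpleGraph X}

/-- `Γ` acts on the vertices of `T` without fixed points. -/
def ActsFreely (Γ : Subgroup (T ≃g T)) : Prop :=
  ∀ γ ∈ Γ, γ ≠ 1 → ∀ x : X, γ x ≠ x

/-- The equivalence relation on the vertices of `T` whose classes are the `Γ`-orbits. -/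
def orbitSetoid (Γ : Subgroup (T ≃g T)) : Setoid X where
  r x y := ∃ γ ∈ Γ, γ x = y
  iseqv :=
    { refl := fun _ => ⟨1, Γ.one_mem, rfl⟩
      symm := by
        rintro x y ⟨γ, hγ, rfl⟩
        exact ⟨γ⁻¹, Γ.inv_mem hγ, γ.symm_apply_apply x⟩
      trans := by
        rintro x y z ⟨γ, hγ, rfl⟩ ⟨δ, hδ, rfl⟩
        exact ⟨δ * γ, Γ.mul_mem hδ hγ, rfl⟩ }

/-- The vertex set `V = Γ \ V(T)` of the quotient graph. -/
def Vert (Γ : Subgroup (T ≃g T)) : Type _ := Quotient (orbitSetoid Γ)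

/-- The projection `V(T) → Γ \ V(T)`. -/
def proj (Γ : Subgroup (T ≃g T)) (x : X) : Vert Γ := Quotient.mk (orbitSetoid Γ) x

/-- The simple graph underlying the quotient graph: two distinct orbits are adjacent when they are
joined by at least one edge. -/
def underlyingGraph (Γ : Subgroup (T ≃g T)) : SimpleGraph (Vert Γ) where
  Adj a b := a ≠ b ∧ ∃ x y : X, T.Adj x y ∧ proj Γ x = a ∧ proj Γ y = b
  symm := ⟨by
    rintro a b ⟨hab, x, y, hxy, hx, hy⟩
    exact ⟨hab.symm, y, x, hxy.symm, hy, hx⟩⟩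
  loopless := ⟨fun _ h => h.1 rfl⟩

/-- The graph distance of the quotient graph (loops and multiplicities of edges do not matter). -/
def qdist (Γ : Subgroup (T ≃g T)) (a b : Vert Γ) : ℕ := (underlyingGraph Γ).dist a b

/-- The ball `B(a, r)` in the quotient graph. -/
def qball (Γ : Subgroup (T ≃g T)) (a : Vert Γ) (r : ℕ) : Set (Vert Γ) := {b | qdist Γ a b ≤ r}

/-- The ball `B(a, r)`, with all the edges of the quotient graph between its vertices, is a tree:
there are no loops, any two (oriented) edges with the same end points are the same edge of the
quotient, and the underlying simple graph is a tree. -/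
structure BallIsTree (Γ : Subgroup (T ≃g T)) (a : Vert Γ) (r : ℕ) : Prop where
  no_loop : ∀ x y : X, T.Adj x y → proj Γ x ∈ qball Γ a r → proj Γ x ≠ proj Γ y
  no_multiple_edge : ∀ x y x' y' : X, T.Adj x y → T.Adj x' y' →
    proj Γ x ∈ qball Γ a r → proj Γ y ∈ qball Γ a r →
    proj Γ x = proj Γ x' → proj Γ y = proj Γ y' → ∃ γ ∈ Γ, γ x = x' ∧ γ y = y'
  isTree : ((underlyingGraph Γ).induce (qball Γ a r)).IsTree

/-- The injectivity radius `ρ(a)`: the largest `r` such that the ball `B(a, r)` is a tree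
(with value `⊤` if all balls around `a` are trees, and `0` if there is a loop at `a`). -/
def injRadius (Γ : Subgroup (T ≃g T)) (a : Vert Γ) : ℕ∞ :=
  ⨆ (r : ℕ) (_ : BallIsTree Γ a r), (r : ℕ∞)

/-- The adjacency operator of `T` on `Γ`-invariant functions, regarded as functions on the
quotient: the value of `𝒜 f` at the orbit of `x` is the sum of the values of `f` at the orbits of
the neighbours `y` of `x` in `T`. -/
def adjFun [T.LocallyFinite] (Γ : Subgroup (T ≃g T)) (f : Vert Γ → ℂ) : Vert Γ → ℂ :=
  Quotient.lift (s := orbitSetoid Γ) (fun x : X => ∑ y ∈ T.neighborFinset x, f (proj Γ y)) (by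
    rintro x _ ⟨γ, hγ, rfl⟩
    refine Finset.sum_bij (fun y _ => γ y) ?_ ?_ ?_ ?_
    · intro y hy
      simpa [γ.map_adj_iff] using hy
    · intro y _ z _ h
      exact γ.injective h
    · intro z hz
      refine ⟨γ.symm z, ?_, by simp⟩
      rw [SimpleGraph.mem_neighborFinset] at hz ⊢
      rw [← γ.map_adj_iff]
      simpa using hz
    · intro y _
      exact congrArg f (Quotient.sound (s := orbitSetoid Γ) ⟨γ, hγ, rfl⟩))

theorem adjFun_proj [T.LocallyFinite] (Γ : Subgroup (T ≃g T)) (f : Vert Γ → ℂ) (x : X) :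
    adjFun Γ f (proj Γ x) = ∑ y ∈ T.neighborFinset x, f (proj Γ y) := rfl

/-- The adjacency operator `𝒜` as a linear operator on `ℓ²(V)`, where `V` carries the counting
measure. -/
def adjOp [T.LocallyFinite] (Γ : Subgroup (T ≃g T)) [Fintype (Vert Γ)] :
    EuclideanSpace ℂ (Vert Γ) →ₗ[ℂ] EuclideanSpace ℂ (Vert Γ) where
  toFun f := WithLp.toLp 2 (adjFun Γ f)
  map_add' f g := by
    ext a
    induction a using Quotient.inductionOn with
    | h x => exact Finset.sum_add_distrib
  map_smul' c f := by
    ext a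
    induction a using Quotient.inductionOn with
    | h x => exact (Finset.mul_sum _ _ _).symm

/-- The kernel `K(a, b) = ⟨δ_a, K δ_b⟩` of an operator on `ℓ²(V)`. -/
def kernel {V : Type*} [Fintype V] (K : EuclideanSpace ℂ V →ₗ[ℂ] EuclideanSpace ℂ V)
    (a b : V) : ℂ :=
  inner ℂ (EuclideanSpace.basisFun V ℂ a) (K (EuclideanSpace.basisFun V ℂ b))

/-- (EXP): there is `β > 0` such that, for all the graphs of the sequence, the spectrum of
`(q+1)⁻¹ 𝒜` on `ℓ²(V)` is contained in `{1} ∪ [-1+β, 1-β]`. -/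
def EXP [T.LocallyFinite] (q : ℕ) (Γ : ℕ → Subgroup (T ≃g T)) [∀ n, Fintype (Vert (Γ n))] : Prop :=
  ∃ β : ℝ, 0 < β ∧ ∀ n,
    spectrum ℂ (((q : ℂ) + 1)⁻¹ • adjOp (Γ n)) ⊆
      (fun t : ℝ => (t : ℂ)) '' ({1} ∪ Set.Icc (-1 + β) (1 - β))

/-- (BST): for every `R`, the proportion of vertices whose injectivity radius is less than `R`
tends to `0`. -/
def BST (Γ : ℕ → Subgroup (T ≃g T)) [∀ n, Fintype (Vert (Γ n))] : Prop :=
  ∀ R : ℕ, Tendsto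
    (fun n => (Set.ncard {a : Vert (Γ n) | injRadius (Γ n) a < R} : ℝ) /
      Fintype.card (Vert (Γ n))) atTop (𝓝 0)

end Quotient

/-! ### Spherical functions -/

/-- `s` is a spectral parameter of `lam`, that is, `lam = 2 √q cos (s ln q)`. -/
def IsSpectralParameter (q : ℕ) (lam : ℝ) (s : ℂ) : Prop :=
  (lam : ℂ) = 2 * (Real.sqrt q : ℂ) * Complex.cos (s * (Real.log q : ℂ))

/-- The quotient `sin ((d+1) θ) / sin θ`, extended by continuity to the zeros of the
denominator, where `cos θ = ±1` and the value is `(d+1) (cos θ) ^ d`. -/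
def sinQuotient (d : ℕ) (θ : ℂ) : ℂ :=
  if Complex.sin θ = 0 then ((d : ℂ) + 1) * Complex.cos θ ^ d
  else Complex.sin (((d : ℂ) + 1) * θ) / Complex.sin θ

/-- The spherical function in terms of the spectral parameter `s`. -/
def sphericalOfParameter (q : ℕ) (s : ℂ) (d : ℕ) : ℂ :=
  (((q : ℝ) ^ (-(d : ℝ) / 2) : ℝ) : ℂ) *
    (2 / ((q : ℂ) + 1) * Complex.cos ((d : ℂ) * (s * (Real.log q : ℂ))) +
      ((q : ℂ) - 1) / ((q : ℂ) + 1) * sinQuotient d (s * (Real.log q : ℂ)))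

/-- The spherical function `Φ_lam(d)`, computed from any spectral parameter of `lam`; by
`exists_isSpectralParameter` and `spherical_eq` below there is one, and the value does not depend
on its choice. -/
def spherical (q : ℕ) (lam : ℝ) (d : ℕ) : ℂ :=
  sphericalOfParameter q (Classical.epsilon (IsSpectralParameter q lam)) d

theorem exists_isSpectralParameter {q : ℕ} (hq : 2 ≤ q) (lam : ℝ) :
    ∃ s : ℂ, IsSpectralParameter q lam s := by
  have hq' : (1 : ℝ) < q := by exact_mod_cast hq
  have hlog : (Real.log q : ℂ) ≠ 0 := by exact_mod_cast (Real.log_pos hq').ne'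
  have hsq : (Real.sqrt q : ℂ) ≠ 0 := by
    exact_mod_cast (Real.sqrt_pos.2 (by linarith : (0 : ℝ) < q)).ne'
  obtain ⟨θ, hθ⟩ := Complex.cos_surjective ((lam : ℂ) / (2 * (Real.sqrt q : ℂ)))
  refine ⟨θ / (Real.log q : ℂ), ?_⟩
  unfold IsSpectralParameter
  rw [div_mul_cancel₀ _ hlog, hθ]
  field_simp

theorem sinQuotient_eq (d : ℕ) (θ : ℂ) :
    sinQuotient d θ = (Polynomial.Chebyshev.U ℂ d).eval (Complex.cos θ) := by
  unfold sinQuotient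
  have hU := Polynomial.Chebyshev.U_complex_cos θ (d : ℤ)
  split_ifs with h
  · have h1 : Complex.cos θ = 1 ∨ Complex.cos θ = -1 := by
      have := Complex.sin_sq_add_cos_sq θ
      rw [h] at this
      exact mul_self_eq_one_iff.1 (by simpa [sq] using this)
    rcases h1 with h1 | h1
    · simp [h1, Polynomial.Chebyshev.U_eval_one]
    · simp [h1, mul_comm]
  · rw [div_eq_iff h, hU]
    simp

/-- The spherical function in terms of Chebyshev polynomials. -/
theorem sphericalOfParameter_eq {q : ℕ} (hq : 2 ≤ q) {lam : ℝ} {s : ℂ}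
    (hs : IsSpectralParameter q lam s) (d : ℕ) :
    sphericalOfParameter q s d = (((q : ℝ) ^ (-(d : ℝ) / 2) : ℝ) : ℂ) *
      (2 / ((q : ℂ) + 1) *
          (Polynomial.Chebyshev.T ℂ d).eval ((lam : ℂ) / (2 * (Real.sqrt q : ℂ))) +
        ((q : ℂ) - 1) / ((q : ℂ) + 1) *
          (Polynomial.Chebyshev.U ℂ d).eval ((lam : ℂ) / (2 * (Real.sqrt q : ℂ)))) := by
  have hsq : (Real.sqrt q : ℂ) ≠ 0 := by
    have : (0 : ℝ) < q := by exact_mod_cast (by omega : 0 < q)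
    exact_mod_cast (Real.sqrt_pos.2 this).ne'
  have hc : (lam : ℂ) / (2 * (Real.sqrt q : ℂ)) = Complex.cos (s * (Real.log q : ℂ)) := by
    rw [hs]
    field_simp
  rw [hc, Polynomial.Chebyshev.T_complex_cos, ← sinQuotient_eq]
  simp [sphericalOfParameter]

/-- `Φ_lam(d)` can be computed from any spectral parameter of `lam`. -/
theorem spherical_eq {q : ℕ} (hq : 2 ≤ q) {lam : ℝ} {s : ℂ}
    (hs : IsSpectralParameter q lam s) (d : ℕ) :
    spherical q lam d = sphericalOfParameter q s d := by
  rw [sphericalOfParameter_eq hq hs, spherical,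
    sphericalOfParameter_eq hq (Classical.epsilon_spec ⟨s, hs⟩)]

/-- The number `⟨K⟩_lam = (1 / |V|) ∑_{a, b} K(a, b) Φ_lam(d(a, b))`. -/
def sphericalMean {X : Type*} {T : SimpleGraph X} (q : ℕ) (Γ : Subgroup (T ≃g T))
    [Fintype (Vert Γ)] (K : EuclideanSpace ℂ (Vert Γ) →ₗ[ℂ] EuclideanSpace ℂ (Vert Γ))
    (lam : ℝ) : ℂ :=
  (1 / (Fintype.card (Vert Γ) : ℂ)) *
    ∑ a, ∑ b, kernel K a b * spherical q lam (qdist Γ a b)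

end

end QuantumErgodicity

/-!
Quantum ergodicity on large regular graphs, by a rigidity argument for the commutant of the
adjacency operator.

Let `e_j` be the diagonal matrix element of the observable in the state `ψ_j`, minus its predicted
mean, and let `E = ∑ e_j |ψ_j⟩⟨ψ_j|`. The quantum variance `∑ |e_j|²` is the Hilbert–Schmidt pairing
of the observable, centered at each distance `k`, with `E` (`sum_norm_sq_eq_pairing`). The centering
constants reproduce exactly the spherical mean, because a sphere sum of an eigenfunction is a
multiple of the eigenfunction (`sum_sphere_eigenfunction`). So it is enough to show that, at each
fixed distance `k ≤ D`, the kernel of `E` is close in mean square to a constant.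

The only property of `E` that is used, besides a uniform bound for its entries, is that it commutes
with `𝒜`. Lift `E` to a kernel `E(x, y)` on the tree and split the commutator with `𝒜` into the part
`outC` that reads the kernel at pairs farther apart by one and the part `inC` that reads it at pairs
closer by one. Then `outC E = - inC E`, and the second difference `Q = outC (outC E)` has a mean
value property: extending a pair by one step at both ends in all possible ways multiplies `Q` by `q`
(`outL_outR_outC_outC`). By the Cauchy–Schwarz inequality the `ℓ²` mass of `Q` at distance `k` is at
most a constant times the mass of `E` at distance `k + 2 u + 2`, for every `u`
(`mass_norm_sq_outC_outC_le`). Where the injectivity radius is large, these masses add up to at most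
the squared Hilbert–Schmidt norm of `E`, which is `O(|V|)` (`sum_mass_norm_sq_le`). Averaging over
`u < U` thus gives a mass of `Q` of size `O(|V| / U)`.

Summation by parts turns the smallness of `Q` into that of the first difference `inC E`
(`mass_norm_sq_inC_le`), whose value at a path is the difference of `E` at the two ends of a
non-backtracking shift. A kernel that is nearly invariant under such shifts nearly does not depend
on the last step of the path, since two paths that differ only there have a common extension on the
other side; here `q ≥ 2` enters. Induction on `k` then leaves a function on the vertices with small
gradient, which is nearly constant by the spectral gap (`exists_mass_norm_sq_sub_const_le`,
`exists_gap`).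

Sums over pairs of vertices modulo the group are taken over representatives of the first vertex;
freeness of the action makes both end points interchangeable (`mass_flip`).
-/

namespace QuantumErgodicity

open Finset SimpleGraph

noncomputable section

/-! ### Distances in trees -/

theorem exists_adj_dist_add_one {X : Type*} {G : SimpleGraph X} {x y : X}
    (h : G.dist x y ≠ 0) : ∃ z, G.Adj x z ∧ G.dist z y + 1 = G.dist x y := by
  obtain ⟨p, hp⟩ := (Reachable.of_dist_ne_zero h).exists_walk_length_eq_dist
  cases p with
  | nil => simp at h
  | @cons _ z _ hadj p =>
    refine ⟨z, hadj, ?_⟩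
    have h1 := dist_le p
    have h2 : G.dist x y ≤ G.dist x z + G.dist z y := p.reachable.dist_triangle_right x
    rw [dist_eq_one_iff_adj.2 hadj] at h2
    rw [Walk.length_cons] at hp
    omega

/-- In a tree, a vertex `x ≠ y` has only one neighbour closer to `y`. -/
theorem _root_.SimpleGraph.IsTree.eq_of_adj_of_dist_add_one {X : Type*} {G : SimpleGraph X}
    (hG : G.IsTree) {x y z w : X} (hz : G.Adj x z) (hzd : G.dist z y + 1 = G.dist x y)
    (hw : G.Adj x w) (hwd : G.dist w y + 1 = G.dist x y) : z = w := by
  obtain ⟨p, hp⟩ := hG.connected.exists_walk_length_eq_dist z y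
  obtain ⟨p', hp'⟩ := hG.connected.exists_walk_length_eq_dist w y
  have h1 : (Walk.cons hz p).IsPath := Walk.isPath_of_length_eq_dist _ (by simp [hp, hzd])
  have h2 : (Walk.cons hw p').IsPath := Walk.isPath_of_length_eq_dist _ (by simp [hp', hwd])
  have h3 := (hG.existsUnique_path x y).unique h1 h2
  have h4 := congrArg Walk.snd h3
  simpa using h4

theorem dist_map_iso {X : Type*} {G : SimpleGraph X} (γ : G ≃g G) (x y : X) :
    G.dist (γ x) (γ y) = G.dist x y := by
  have key : ∀ (δ : G ≃g G) (x y : X), G.Reachable x y → G.dist (δ x) (δ y) ≤ G.dist x y := by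
    intro δ x y h
    obtain ⟨p, hp⟩ := h.exists_walk_length_eq_dist
    rw [← hp, ← Walk.length_map δ.toHom p]
    exact dist_le (p.map δ.toHom)
  by_cases h : G.Reachable x y
  · refine le_antisymm (key γ x y h) ?_
    have := key γ.symm (γ x) (γ y) (h.map γ.toHom)
    simpa using this
  · have h' : ¬ G.Reachable (γ x) (γ y) := fun h' => h (by simpa using h'.map γ.symm.toHom)
    rw [dist_eq_zero_of_not_reachable h, dist_eq_zero_of_not_reachable h']

section Kernels

variable {X : Type*} (T : SimpleGraph X) [T.LocallyFinite]

/-! ### Moving one end point of a pair of vertices -/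

/-- The sum of a kernel over the neighbours of its first variable that are farther from the
second one. -/
def outL {M : Type*} [AddCommMonoid M] (F : X → X → M) (x y : X) : M :=
  ∑ z ∈ T.neighborFinset x with T.dist z y = T.dist x y + 1, F z y

/-- The sum of a kernel over the neighbours of its first variable that are closer to the second
one. -/
def inL {M : Type*} [AddCommMonoid M] (F : X → X → M) (x y : X) : M :=
  ∑ z ∈ T.neighborFinset x with T.dist z y + 1 = T.dist x y, F z y

/-- The sum of a kernel over the neighbours of its second variable that are farther from the
first one. -/
def outR {M : Type*} [AddCommMonoid M] (F : X → X → M) (x y : X) : M :=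
  outL T (fun a b => F b a) y x

/-- The sum of a kernel over the neighbours of its second variable that are closer to the first
one. -/
def inR {M : Type*} [AddCommMonoid M] (F : X → X → M) (x y : X) : M :=
  inL T (fun a b => F b a) y x

theorem outR_apply {M : Type*} [AddCommMonoid M] (F : X → X → M) (x y : X) :
    outR T F x y = ∑ z ∈ T.neighborFinset y with T.dist x z = T.dist x y + 1, F x z := by
  unfold outR outL
  simp only [dist_comm (v := x)]

theorem inR_apply {M : Type*} [AddCommMonoid M] (F : X → X → M) (x y : X) :
    inR T F x y = ∑ z ∈ T.neighborFinset y with T.dist x z + 1 = T.dist x y, F x z := by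
  unfold inR inL
  simp only [dist_comm (v := x)]

/-- A kernel is extended at both ends at once when its distance grows by two, in whichever order
this is done. -/
theorem outL_outR {M : Type*} [AddCommMonoid M] (hT : T.Connected) (F : X → X → M) :
    outL T (outR T F) = outR T (outL T F) := by
  have hd : ∀ {a b : X}, b ∈ T.neighborFinset a → T.dist a b = 1 := fun h =>
    dist_eq_one_iff_adj.2 ((T.mem_neighborFinset _ _).1 h)
  have h1 : ∀ x y, outL T (outR T F) x y = ∑ z ∈ T.neighborFinset x, ∑ w ∈ T.neighborFinset y,
      if T.dist z w = T.dist x y + 2 then F z w else 0 := by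
    intro x y
    simp only [outL, outR_apply, Finset.sum_filter]
    refine Finset.sum_congr rfl fun z hz => ?_
    split_ifs with h
    · rw [h]
    · refine (Finset.sum_eq_zero fun w hw => if_neg fun h' => h ?_).symm
      have := hd hz
      have := hd hw
      have := hT.dist_triangle (u := z) (v := y) (w := w)
      have := hT.dist_triangle (u := z) (v := x) (w := y)
      have := T.dist_comm (u := x) (v := z)
      omega
  have h2 : ∀ x y, outR T (outL T F) x y = ∑ w ∈ T.neighborFinset y, ∑ z ∈ T.neighborFinset x,
      if T.dist z w = T.dist x y + 2 then F z w else 0 := by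
    intro x y
    simp only [outR_apply, outL, Finset.sum_filter]
    refine Finset.sum_congr rfl fun w hw => ?_
    split_ifs with h
    · rw [h]
    · refine (Finset.sum_eq_zero fun z hz => if_neg fun h' => h ?_).symm
      have := hd hz
      have := hd hw
      have := hT.dist_triangle (u := z) (v := x) (w := w)
      have := hT.dist_triangle (u := x) (v := y) (w := w)
      have := T.dist_comm (u := x) (v := z)
      omega
  funext x y
  rw [h1, h2, Finset.sum_comm]

theorem inL_inR {M : Type*} [AddCommMonoid M] (hT : T.Connected) (F : X → X → M) :
    inL T (inR T F) = inR T (inL T F) := by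
  have hd : ∀ {a b : X}, b ∈ T.neighborFinset a → T.dist a b = 1 := fun h =>
    dist_eq_one_iff_adj.2 ((T.mem_neighborFinset _ _).1 h)
  have h1 : ∀ x y, inL T (inR T F) x y = ∑ z ∈ T.neighborFinset x, ∑ w ∈ T.neighborFinset y,
      if T.dist z w + 2 = T.dist x y then F z w else 0 := by
    intro x y
    simp only [inL, inR_apply, Finset.sum_filter]
    refine Finset.sum_congr rfl fun z hz => ?_
    split_ifs with h
    · simp only [← h,
        show ∀ m n : ℕ, (m + 2 = n + 1) ↔ m + 1 = n by omega]
    · refine (Finset.sum_eq_zero fun w hw => if_neg fun h' => h ?_).symm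
      have := hd hz
      have := hd hw
      have := hT.dist_triangle (u := z) (v := w) (w := y)
      have := hT.dist_triangle (u := x) (v := z) (w := y)
      have := T.dist_comm (u := y) (v := w)
      omega
  have h2 : ∀ x y, inR T (inL T F) x y = ∑ w ∈ T.neighborFinset y, ∑ z ∈ T.neighborFinset x,
      if T.dist z w + 2 = T.dist x y then F z w else 0 := by
    intro x y
    simp only [inR_apply, inL, Finset.sum_filter]
    refine Finset.sum_congr rfl fun w hw => ?_
    split_ifs with h
    · simp only [← h,
        show ∀ m n : ℕ, (m + 2 = n + 1) ↔ m + 1 = n by omega]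
    · refine (Finset.sum_eq_zero fun z hz => if_neg fun h' => h ?_).symm
      have := hd hz
      have := hd hw
      have := hT.dist_triangle (u := x) (v := z) (w := w)
      have := hT.dist_triangle (u := x) (v := w) (w := y)
      have := T.dist_comm (u := y) (v := w)
      omega
  funext x y
  rw [h1, h2, Finset.sum_comm]

/-- In a tree, every neighbour of `x` is either farther from `y` or closer to it. -/
theorem outL_add_inL {M : Type*} [AddCommMonoid M] (hT : T.IsTree) (F : X → X → M) (x y : X) :
    outL T F x y + inL T F x y = ∑ z ∈ T.neighborFinset x, F z y := by
  unfold outL inL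
  rw [← Finset.sum_filter_add_sum_filter_not (T.neighborFinset x)
    (fun z => T.dist z y = T.dist x y + 1) (fun z => F z y)]
  congr 1
  refine Finset.sum_congr (Finset.filter_congr fun z hz => ?_) fun _ _ => rfl
  have := hT.dist_eq_dist_add_one_of_adj y ((T.mem_neighborFinset _ _).1 hz)
  rw [T.dist_comm, T.dist_comm (u := y)] at this
  omega

theorem outR_add_inR {M : Type*} [AddCommMonoid M] (hT : T.IsTree) (F : X → X → M) (x y : X) :
    outR T F x y + inR T F x y = ∑ z ∈ T.neighborFinset y, F x z :=
  outL_add_inL T hT (fun a b => F b a) y x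

theorem inL_eq {M : Type*} [AddCommMonoid M] (hT : T.IsTree) (F : X → X → M) {x y z : X}
    (hz : T.Adj x z) (hd : T.dist z y + 1 = T.dist x y) : inL T F x y = F z y := by
  unfold inL
  have : ({w ∈ T.neighborFinset x | T.dist w y + 1 = T.dist x y} : Finset X) = {z} := by
    ext w
    simp only [Finset.mem_filter, mem_neighborFinset, Finset.mem_singleton]
    exact ⟨fun h => hT.eq_of_adj_of_dist_add_one h.1 h.2 hz hd, fun h => h ▸ ⟨hz, hd⟩⟩
  rw [this, Finset.sum_singleton]

theorem inR_eq {M : Type*} [AddCommMonoid M] (hT : T.IsTree) (F : X → X → M) {x y z : X}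
    (hz : T.Adj y z) (hd : T.dist x z + 1 = T.dist x y) : inR T F x y = F x z :=
  inL_eq T hT _ hz (by rwa [T.dist_comm, T.dist_comm (u := y)])

theorem inL_eq_zero {M : Type*} [AddCommMonoid M] (F : X → X → M) {x y : X}
    (h : T.dist x y = 0) : inL T F x y = 0 := by
  unfold inL
  refine Finset.sum_eq_zero fun z hz => ?_
  rw [Finset.mem_filter] at hz
  omega

theorem exists_inL_eq {M : Type*} [AddCommMonoid M] (hT : T.IsTree) {x y : X}
    (h : T.dist x y ≠ 0) : ∃ z, T.Adj x z ∧ T.dist z y + 1 = T.dist x y ∧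
      ∀ F : X → X → M, inL T F x y = F z y := by
  obtain ⟨z, hz, hd⟩ := exists_adj_dist_add_one h
  exact ⟨z, hz, hd, fun F => inL_eq T hT F hz hd⟩

/-- Pulling a pointwise map through the sum `inL`, which has at most one term. -/
theorem inL_map {M N : Type*} [AddCommMonoid M] [AddCommMonoid N] (hT : T.IsTree)
    (φ : M → N) (hφ : φ 0 = 0) (F : X → X → M) (x y : X) :
    inL T (fun a b => φ (F a b)) x y = φ (inL T F x y) := by
  by_cases h : T.dist x y = 0
  · rw [inL_eq_zero T _ h, inL_eq_zero T _ h, hφ]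
  · obtain ⟨z, hz, hd⟩ := exists_adj_dist_add_one h
    rw [inL_eq T hT _ hz hd, inL_eq T hT _ hz hd]

theorem inR_map {M N : Type*} [AddCommMonoid M] [AddCommMonoid N] (hT : T.IsTree)
    (φ : M → N) (hφ : φ 0 = 0) (F : X → X → M) (x y : X) :
    inR T (fun a b => φ (F a b)) x y = φ (inR T F x y) :=
  inL_map T hT φ hφ (fun a b => F b a) y x

/-- The operations `outL` and `inL` are adjoint to each other, already before summation. -/
theorem outL_inL_mul (hT : T.IsTree) (F G : X → X → ℂ) (x y : X) :
    outL T (fun a b => inL T F a b * G a b) x y = F x y * outL T G x y := by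
  unfold outL
  rw [Finset.mul_sum]
  refine Finset.sum_congr rfl fun z hz => ?_
  rw [Finset.mem_filter, mem_neighborFinset] at hz
  simp only [inL_eq T hT F hz.1.symm hz.2.symm]

theorem outR_inR_mul (hT : T.IsTree) (F G : X → X → ℂ) (x y : X) :
    outR T (fun a b => inR T F a b * G a b) x y = F x y * outR T G x y :=
  outL_inL_mul T hT (fun a b => F b a) (fun a b => G b a) y x

variable {q : ℕ}

theorem card_out (hT : T.IsTree) (hreg : T.IsRegularOfDegree (q + 1)) (x y : X) :
    #{z ∈ T.neighborFinset x | T.dist z y = T.dist x y + 1} =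
      if T.dist x y = 0 then q + 1 else q := by
  have h := outL_add_inL T hT (fun _ _ => 1) x y
  rw [Finset.sum_const, card_neighborFinset_eq_degree, hreg x] at h
  have h1 : outL T (fun _ _ => 1) x y =
      #{z ∈ T.neighborFinset x | T.dist z y = T.dist x y + 1} := by
    simp [outL]
  rw [h1] at h
  split_ifs with h0
  · rw [inL_eq_zero T _ h0] at h
    simpa using h
  · obtain ⟨z, hz, hd⟩ := exists_adj_dist_add_one h0
    rw [inL_eq T hT _ hz hd] at h
    simpa using h

theorem outL_inL {M : Type*} [AddCommMonoid M] (hT : T.IsTree)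
    (hreg : T.IsRegularOfDegree (q + 1)) (F : X → X → M) (x y : X) :
    outL T (inL T F) x y = (if T.dist x y = 0 then q + 1 else q) • F x y := by
  rw [← card_out T hT hreg, ← Finset.sum_const]
  refine Finset.sum_congr rfl fun z hz => ?_
  rw [Finset.mem_filter, mem_neighborFinset] at hz
  exact inL_eq T hT F hz.1.symm hz.2.symm

theorem outR_inR {M : Type*} [AddCommMonoid M] (hT : T.IsTree)
    (hreg : T.IsRegularOfDegree (q + 1)) (F : X → X → M) (x y : X) :
    outR T (inR T F) x y = (if T.dist x y = 0 then q + 1 else q) • F x y := by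
  rw [T.dist_comm]
  exact outL_inL T hT hreg (fun a b => F b a) y x

theorem outL_congr {M : Type*} [AddCommMonoid M] {F G : X → X → M}
    (h : ∀ x y, T.dist x y ≠ 0 → F x y = G x y) : outL T F = outL T G := by
  funext x y
  refine Finset.sum_congr rfl fun z hz => h z y ?_
  rw [Finset.mem_filter] at hz
  omega

theorem outR_congr {M : Type*} [AddCommMonoid M] {F G : X → X → M}
    (h : ∀ x y, T.dist x y ≠ 0 → F x y = G x y) : outR T F = outR T G := by
  funext x y
  refine congrFun (congrFun (outL_congr T fun a b hab => h b a ?_) y) x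
  rwa [T.dist_comm]

theorem outL_sub (F G : X → X → ℂ) : outL T (F - G) = outL T F - outL T G := by
  funext x y; simp [outL, Finset.sum_sub_distrib]

theorem inL_sub (F G : X → X → ℂ) : inL T (F - G) = inL T F - inL T G := by
  funext x y; simp [inL, Finset.sum_sub_distrib]

theorem outR_sub (F G : X → X → ℂ) : outR T (F - G) = outR T F - outR T G := by
  funext x y; simp [outR_apply, Finset.sum_sub_distrib]

theorem inR_sub (F G : X → X → ℂ) : inR T (F - G) = inR T F - inR T G := by
  funext x y; simp [inR_apply, Finset.sum_sub_distrib]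

theorem outL_smul (c : ℂ) (F : X → X → ℂ) : outL T (c • F) = c • outL T F := by
  funext x y; simp [outL, Finset.mul_sum]

theorem outR_smul (c : ℂ) (F : X → X → ℂ) : outR T (c • F) = c • outR T F := by
  funext x y; simp [outR_apply, Finset.mul_sum]

/-! ### Kernels that commute with the adjacency operator -/

/-- The part of the commutator with the adjacency operator that lowers the distance: the value at
a pair collects the values at pairs that are farther apart by one. -/
def outC (F : X → X → ℂ) : X → X → ℂ := outL T F - outR T F

/-- The part of the commutator with the adjacency operator that raises the distance: the value at
a pair is the difference of the values at the two pairs obtained by shortening it. -/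
def inC (F : X → X → ℂ) : X → X → ℂ := inL T F - inR T F

theorem outC_smul (c : ℂ) (F : X → X → ℂ) : outC T (c • F) = c • outC T F := by
  unfold outC; rw [outL_smul, outR_smul, smul_sub]

theorem inC_sub (F G : X → X → ℂ) : inC T (F - G) = inC T F - inC T G := by
  unfold inC; rw [inL_sub, inR_sub]; abel

theorem outC_eq_neg_inC (hT : T.IsTree) {E : X → X → ℂ}
    (hE : ∀ x y, ∑ z ∈ T.neighborFinset x, E z y = ∑ z ∈ T.neighborFinset y, E x z) :
    outC T E = - inC T E := by
  funext x y
  have h := hE x y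
  rw [← outL_add_inL T hT, ← outR_add_inR T hT] at h
  simp only [outC, inC, Pi.sub_apply, Pi.neg_apply]
  linear_combination h

theorem outL_outR_outC (hT : T.Connected) (F : X → X → ℂ) :
    outL T (outR T (outC T F)) = outC T (outL T (outR T F)) := by
  unfold outC
  rw [outR_sub, outL_sub, ← outL_outR T hT (outR T F), outL_outR T hT F]

/-- Key identity: if `E` commutes with the adjacency operator, then the second difference
`Q = outC (outC E)` satisfies a mean value property under the simultaneous extension of both end
points. In terms of the distances `u` and `v` by which the two ends have been moved, `E` solves
the discrete wave equation, and `Q` is constant along its characteristics. -/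
theorem outL_outR_outC_outC (hT : T.IsTree) (hreg : T.IsRegularOfDegree (q + 1)) {E : X → X → ℂ}
    (hE : ∀ x y, ∑ z ∈ T.neighborFinset x, E z y = ∑ z ∈ T.neighborFinset y, E x z) :
    outL T (outR T (outC T (outC T E))) = (q : ℂ) • outC T (outC T E) := by
  have hc := hT.connected
  have h1 : outL T (outR T (outC T E)) = (q : ℂ) • outC T E := by
    rw [outC_eq_neg_inC T hT hE, show -inC T E = inR T E - inL T E by unfold inC; abel,
      outR_sub, outL_sub, outL_outR T hc (inL T E)]
    have e1 : outL T (outR T (inR T E)) = outL T ((q : ℂ) • E) := outL_congr T fun x y h => by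
      rw [outR_inR T hT hreg, if_neg h]; simp
    have e2 : outR T (outL T (inL T E)) = outR T ((q : ℂ) • E) := outR_congr T fun x y h => by
      rw [outL_inL T hT hreg, if_neg h]; simp
    rw [e1, e2, outL_smul, outR_smul, ← smul_sub, show inR T E - inL T E = outC T E by
      rw [outC_eq_neg_inC T hT hE]; unfold inC; abel]
    rfl
  rw [outL_outR_outC T hc, h1, outC_smul]

end Kernels

section Orbits

variable {X : Type*} {T : SimpleGraph X}

/-! ### Orbits and invariant kernels -/

variable (Γ : Subgroup (T ≃g T))

/-- A chosen vertex in an orbit. -/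
def rep (a : Vert Γ) : X := Quotient.out (s := orbitSetoid Γ) a

theorem proj_rep (a : Vert Γ) : proj Γ (rep Γ a) = a := Quotient.out_eq (s := orbitSetoid Γ) a

theorem proj_eq_iff {x y : X} : proj Γ x = proj Γ y ↔ ∃ γ ∈ Γ, γ x = y :=
  Quotient.eq (r := orbitSetoid Γ)

theorem proj_apply {γ : T ≃g T} (hγ : γ ∈ Γ) (x : X) : proj Γ (γ x) = proj Γ x :=
  ((proj_eq_iff Γ).2 ⟨γ, hγ, rfl⟩).symm

/-- A kernel on the tree is invariant under the diagonal action of the group. -/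
def IsInvariant {M : Type*} (F : X → X → M) : Prop :=
  ∀ γ ∈ Γ, ∀ x y, F (γ x) (γ y) = F x y

variable {Γ}

theorem IsInvariant.map {M N : Type*} {F : X → X → M} (hF : IsInvariant Γ F) (φ : M → N) :
    IsInvariant Γ fun x y => φ (F x y) :=
  fun γ hγ x y => congrArg φ (hF γ hγ x y)

theorem IsInvariant.map₂ {M N P : Type*} {F : X → X → M} {G : X → X → N} (hF : IsInvariant Γ F)
    (hG : IsInvariant Γ G) (φ : M → N → P) : IsInvariant Γ fun x y => φ (F x y) (G x y) :=
  fun γ hγ x y => congrArg₂ φ (hF γ hγ x y) (hG γ hγ x y)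

theorem IsInvariant.flip {M : Type*} {F : X → X → M} (hF : IsInvariant Γ F) :
    IsInvariant Γ fun x y => F y x :=
  fun γ hγ x y => hF γ hγ y x

theorem isInvariant_proj {M : Type*} (f : Vert Γ → Vert Γ → M) :
    IsInvariant Γ fun x y => f (proj Γ x) (proj Γ y) := fun γ hγ x y => by
  simp only [proj_apply Γ hγ]

theorem eq_one_of_apply_eq (hfree : ActsFreely Γ) {γ : T ≃g T} (hγ : γ ∈ Γ) {x : X}
    (h : γ x = x) : γ = 1 := by
  by_contra h1
  exact hfree γ hγ h1 x h

end Orbits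

section Mass

variable {X : Type*} (T : SimpleGraph X) [T.LocallyFinite]

/-! ### Spheres, and sums over pairs of vertices modulo the group -/

open Classical in
/-- The sphere of radius `k` about `x`, in a connected and locally finite graph. -/
def sphere (x : X) : ℕ → Finset X
  | 0 => {x}
  | k + 1 => {z ∈ (sphere x k).biUnion fun y => T.neighborFinset y | T.dist x z = k + 1}

variable {T}

theorem mem_sphere (hT : T.Connected) {x y : X} {k : ℕ} : y ∈ sphere T x k ↔ T.dist x y = k := by
  induction k generalizing y with
  | zero => simp [sphere, hT.dist_eq_zero_iff, eq_comm]
  | succ k ih =>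
    simp only [sphere, Finset.mem_filter, Finset.mem_biUnion, mem_neighborFinset, ih,
      and_iff_right_iff_imp]
    intro h
    obtain ⟨z, hz, hd⟩ := exists_adj_dist_add_one (G := T) (x := y) (y := x)
      (by rw [T.dist_comm, h]; omega)
    rw [T.dist_comm, T.dist_comm (u := y), h] at hd
    exact ⟨z, by omega, hz.symm⟩

variable {q : ℕ}

theorem sum_sphere_outR {M : Type*} [AddCommMonoid M] (hT : T.IsTree) (F : X → X → M) (x : X)
    (k : ℕ) : ∑ y ∈ sphere T x k, outR T F x y = ∑ y ∈ sphere T x (k + 1), F x y := by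
  have hc := hT.connected
  have h : ∀ y ∈ sphere T x k, outR T F x y =
      ∑ z ∈ T.neighborFinset y with T.dist x z = k + 1, F x z := fun y hy => by
    rw [outR_apply, (mem_sphere hc).1 hy]
  have h' : ∀ z ∈ sphere T x (k + 1), F x z =
      ∑ _y ∈ T.neighborFinset z with T.dist x _y = k, F x z := fun z hz => by
    rw [mem_sphere hc] at hz
    obtain ⟨w, hw, hd, hF⟩ := exists_inL_eq (M := M) T hT (x := z) (y := x)
      (by rw [T.dist_comm, hz]; omega)
    refine (hF fun _ _ => F x z).symm.trans ?_
    unfold inL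
    refine Finset.sum_congr (Finset.filter_congr fun y _ => ?_) fun _ _ => rfl
    rw [T.dist_comm, T.dist_comm (u := z), hz]
    omega
  rw [Finset.sum_congr rfl h, Finset.sum_congr rfl h']
  refine Finset.sum_comm' fun y z => ?_
  simp only [Finset.mem_filter, mem_neighborFinset, mem_sphere hc, T.adj_comm y z]
  tauto

/-- The number of vertices of a sphere of radius `k` in the `(q+1)`-regular tree. -/
def sphereCard (q : ℕ) : ℕ → ℕ
  | 0 => 1
  | k + 1 => (q + 1) * q ^ k

theorem sphereCard_pos {q : ℕ} (hq : 2 ≤ q) (k : ℕ) : 0 < sphereCard q k := by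
  cases k <;> simp only [sphereCard] <;> positivity

theorem card_sphere (hT : T.IsTree) (hreg : T.IsRegularOfDegree (q + 1)) (x : X) (k : ℕ) :
    #(sphere T x k) = sphereCard q k := by
  have hrec : ∀ k, #(sphere T x (k + 1)) = #(sphere T x k) * if k = 0 then q + 1 else q := by
    intro k
    have h := sum_sphere_outR hT (fun _ _ => (1 : ℕ)) x k
    rw [Finset.sum_const, smul_eq_mul, mul_one] at h
    rw [← h, ← smul_eq_mul, ← Finset.sum_const]
    refine Finset.sum_congr rfl fun y hy => ?_
    rw [mem_sphere hT.connected] at hy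
    have := card_out T hT hreg y x
    rw [T.dist_comm, hy] at this
    rw [← this, outR_apply, Finset.sum_const, smul_eq_mul, mul_one, hy]
    simp only [T.dist_comm (v := x)]
  induction k with
  | zero => simp [sphere, sphereCard]
  | succ k ih =>
    rw [hrec, ih]
    cases k with
    | zero => simp [sphereCard]
    | succ k => simp only [sphereCard, Nat.add_eq_zero_iff, one_ne_zero, and_false, if_false]; ring

variable {Γ : Subgroup (T ≃g T)}

theorem sum_neighborFinset_apply {M : Type*} [AddCommMonoid M] (γ : T ≃g T) (x : X) (f : X → M) :
    ∑ z ∈ T.neighborFinset (γ x), f z = ∑ z ∈ T.neighborFinset x, f (γ z) := by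
  refine (Finset.sum_bij (fun y _ => γ y) ?_ ?_ ?_ ?_).symm
  · intro y hy
    simpa [γ.map_adj_iff] using hy
  · intro y _ z _ h
    exact γ.injective h
  · intro z hz
    refine ⟨γ.symm z, ?_, by simp⟩
    rw [mem_neighborFinset] at hz ⊢
    rw [← γ.map_adj_iff]
    simpa using hz
  · intro y _
    rfl

theorem IsInvariant.outL {M : Type*} [AddCommMonoid M] {F : X → X → M} (hF : IsInvariant Γ F) :
    IsInvariant Γ (outL T F) := fun γ hγ x y => by
  simp only [QuantumErgodicity.outL, Finset.sum_filter, sum_neighborFinset_apply, dist_map_iso,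
    hF γ hγ]

theorem IsInvariant.inL {M : Type*} [AddCommMonoid M] {F : X → X → M} (hF : IsInvariant Γ F) :
    IsInvariant Γ (inL T F) := fun γ hγ x y => by
  simp only [QuantumErgodicity.inL, Finset.sum_filter, sum_neighborFinset_apply, dist_map_iso,
    hF γ hγ]

theorem IsInvariant.outR {M : Type*} [AddCommMonoid M] {F : X → X → M} (hF : IsInvariant Γ F) :
    IsInvariant Γ (outR T F) := hF.flip.outL.flip

theorem IsInvariant.inR {M : Type*} [AddCommMonoid M] {F : X → X → M} (hF : IsInvariant Γ F) :
    IsInvariant Γ (inR T F) := hF.flip.inL.flip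

theorem IsInvariant.outC {F : X → X → ℂ} (hF : IsInvariant Γ F) : IsInvariant Γ (outC T F) :=
  hF.outL.map₂ hF.outR fun a b => a - b

theorem IsInvariant.inC {F : X → X → ℂ} (hF : IsInvariant Γ F) : IsInvariant Γ (inC T F) :=
  hF.inL.map₂ hF.inR fun a b => a - b

variable [Fintype (Vert Γ)]

variable (Γ) in
/-- The sum of an invariant kernel over the pairs of vertices at distance `k`, modulo the group:
the first vertex runs through representatives of the orbits. -/
def mass {M : Type*} [AddCommMonoid M] (k : ℕ) (F : X → X → M) : M :=
  ∑ a : Vert Γ, ∑ y ∈ sphere T (rep Γ a) k, F (rep Γ a) y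

/-- Mass transport: for a free action it does not matter which of the two end points runs through
the representatives. -/
theorem mass_flip {M : Type*} [AddCommMonoid M] (hT : T.Connected) (hfree : ActsFreely Γ) (k : ℕ)
    {F : X → X → M} (hF : IsInvariant Γ F) : mass Γ k (fun x y => F y x) = mass Γ k F := by
  have hex : ∀ y : X, ∃ γ ∈ Γ, γ y = rep Γ (proj Γ y) := fun y =>
    (proj_eq_iff Γ).1 (proj_rep Γ _).symm
  choose g hgΓ hg using hex
  unfold mass
  rw [Finset.sum_sigma', Finset.sum_sigma']
  have hmem : ∀ p : (_ : Vert Γ) × X, p ∈ Finset.univ.sigma (fun a => sphere T (rep Γ a) k) →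
      (⟨proj Γ p.2, g p.2 (rep Γ p.1)⟩ : (_ : Vert Γ) × X) ∈
        Finset.univ.sigma (fun a => sphere T (rep Γ a) k) := by
    rintro ⟨a, y⟩ h
    simp only [Finset.mem_sigma, Finset.mem_univ, true_and, mem_sphere hT] at h ⊢
    rw [← hg, dist_map_iso, T.dist_comm, h]
  have hinv : ∀ p : (_ : Vert Γ) × X,
      (⟨proj Γ (g p.2 (rep Γ p.1)), g (g p.2 (rep Γ p.1)) (rep Γ (proj Γ p.2))⟩ :
        (_ : Vert Γ) × X) = p := by
    rintro ⟨a, y⟩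
    have h1 : proj Γ (g y (rep Γ a)) = a := by rw [proj_apply Γ (hgΓ y), proj_rep]
    have h2 : g (g y (rep Γ a)) * g y = 1 := by
      refine eq_one_of_apply_eq hfree (Γ.mul_mem (hgΓ _) (hgΓ y)) (x := rep Γ a) ?_
      have := hg (g y (rep Γ a))
      rw [h1] at this
      exact this
    simp only [h1]
    have h3 := congrArg (fun γ : T ≃g T => γ y) h2
    rw [← hg y]
    exact congrArg (Sigma.mk a) h3
  refine Finset.sum_nbij' (fun p => ⟨proj Γ p.2, g p.2 (rep Γ p.1)⟩)
    (fun p => ⟨proj Γ p.2, g p.2 (rep Γ p.1)⟩) hmem hmem (fun p _ => hinv p) (fun p _ => hinv p) ?_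
  rintro ⟨a, y⟩ _
  simp only
  rw [← hg, hF _ (hgΓ y)]

theorem mass_outR {M : Type*} [AddCommMonoid M] (hT : T.IsTree) (k : ℕ) (F : X → X → M) :
    mass Γ k (outR T F) = mass Γ (k + 1) F :=
  Finset.sum_congr rfl fun _ _ => sum_sphere_outR hT F _ k

theorem mass_outL {M : Type*} [AddCommMonoid M] (hT : T.IsTree) (hfree : ActsFreely Γ) (k : ℕ)
    {F : X → X → M} (hF : IsInvariant Γ F) : mass Γ k (outL T F) = mass Γ (k + 1) F := by
  have hc := hT.connected
  rw [← mass_flip hc hfree k hF.outL, ← mass_flip hc hfree (k + 1) hF, ← mass_outR hT]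
  rfl

theorem mass_congr {M : Type*} [AddCommMonoid M] (hT : T.Connected) {k : ℕ} {F G : X → X → M}
    (h : ∀ x y, T.dist x y = k → F x y = G x y) : mass Γ k F = mass Γ k G :=
  Finset.sum_congr rfl fun _ _ => Finset.sum_congr rfl fun _ hy => h _ _ ((mem_sphere hT).1 hy)

theorem mass_mono (hT : T.Connected) {k : ℕ} {F G : X → X → ℝ}
    (h : ∀ x y, T.dist x y = k → F x y ≤ G x y) : mass Γ k F ≤ mass Γ k G :=
  Finset.sum_le_sum fun _ _ => Finset.sum_le_sum fun _ hy => h _ _ ((mem_sphere hT).1 hy)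

theorem mass_nonneg {k : ℕ} {F : X → X → ℝ} (h : ∀ x y, 0 ≤ F x y) : 0 ≤ mass Γ k F :=
  Finset.sum_nonneg fun _ _ => Finset.sum_nonneg fun _ _ => h _ _

theorem mass_add {M : Type*} [AddCommMonoid M] (k : ℕ) (F G : X → X → M) :
    mass Γ k (fun x y => F x y + G x y) = mass Γ k F + mass Γ k G := by
  simp only [mass, Finset.sum_add_distrib]

theorem mass_sub {M : Type*} [AddCommGroup M] (k : ℕ) (F G : X → X → M) :
    mass Γ k (fun x y => F x y - G x y) = mass Γ k F - mass Γ k G := by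
  simp only [mass, Finset.sum_sub_distrib]

theorem mass_mul_left {M : Type*} [NonUnitalNonAssocSemiring M] (k : ℕ) (c : M) (F : X → X → M) :
    mass Γ k (fun x y => c * F x y) = c * mass Γ k F := by
  simp only [mass, Finset.mul_sum]

theorem mass_const (hT : T.IsTree) (hreg : T.IsRegularOfDegree (q + 1)) {M : Type*} [Semiring M]
    (k : ℕ) (c : M) :
    mass Γ k (fun _ _ => c) = Fintype.card (Vert Γ) * sphereCard q k * c := by
  simp only [mass, Finset.sum_const, card_sphere hT hreg, Finset.card_univ, nsmul_eq_mul]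
  rw [mul_assoc]

theorem norm_mass_le (k : ℕ) (F : X → X → ℂ) :
    ‖mass Γ k F‖ ≤ mass Γ k fun x y => ‖F x y‖ :=
  (norm_sum_le _ _).trans (Finset.sum_le_sum fun _ _ => norm_sum_le _ _)

theorem norm_sq_sum_le {ι : Type*} (s : Finset ι) (f : ι → ℂ) :
    ‖∑ i ∈ s, f i‖ ^ 2 ≤ #s * ∑ i ∈ s, ‖f i‖ ^ 2 :=
  (pow_le_pow_left₀ (norm_nonneg _) (norm_sum_le _ _) 2).trans sq_sum_le_card_mul_sum_sq

theorem norm_sub_sq_le (a b : ℂ) : ‖a - b‖ ^ 2 ≤ 2 * ‖a‖ ^ 2 + 2 * ‖b‖ ^ 2 := by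
  have h := norm_sub_le a b
  have h0 := norm_nonneg (a - b)
  nlinarith [sq_nonneg (‖a‖ - ‖b‖)]

/-! ### Smallness of the second difference -/

theorem norm_sq_outL_le (hT : T.IsTree) (hreg : T.IsRegularOfDegree (q + 1)) (F : X → X → ℂ)
    (x y : X) : ‖outL T F x y‖ ^ 2 ≤
      (if T.dist x y = 0 then (q : ℝ) + 1 else q) * outL T (fun a b => ‖F a b‖ ^ 2) x y := by
  have h := norm_sq_sum_le {z ∈ T.neighborFinset x | T.dist z y = T.dist x y + 1} fun z => F z y
  rw [card_out T hT hreg] at h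
  push_cast at h
  exact h

theorem norm_sq_outR_le (hT : T.IsTree) (hreg : T.IsRegularOfDegree (q + 1)) (F : X → X → ℂ)
    (x y : X) : ‖outR T F x y‖ ^ 2 ≤
      (if T.dist x y = 0 then (q : ℝ) + 1 else q) * outR T (fun a b => ‖F a b‖ ^ 2) x y := by
  rw [T.dist_comm]
  exact norm_sq_outL_le hT hreg (fun a b => F b a) y x

theorem outL_nonneg {F : X → X → ℝ} (h : ∀ x y, 0 ≤ F x y) (x y : X) : 0 ≤ outL T F x y :=
  Finset.sum_nonneg fun _ _ => h _ _

theorem outR_nonneg {F : X → X → ℝ} (h : ∀ x y, 0 ≤ F x y) (x y : X) : 0 ≤ outR T F x y :=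
  outL_nonneg (fun x y => h y x) y x

theorem mass_norm_sq_outC_le (hT : T.IsTree) (hreg : T.IsRegularOfDegree (q + 1))
    (hfree : ActsFreely Γ) {F : X → X → ℂ} (hF : IsInvariant Γ F) (k : ℕ) :
    mass Γ k (fun x y => ‖outC T F x y‖ ^ 2) ≤
      4 * (q + 1) * mass Γ (k + 1) fun x y => ‖F x y‖ ^ 2 := by
  have hinv := hF.map fun z => ‖z‖ ^ 2
  calc mass Γ k (fun x y => ‖outC T F x y‖ ^ 2)
      ≤ mass Γ k (fun x y => 2 * (q + 1) * (outL T (fun a b => ‖F a b‖ ^ 2) x y +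
          outR T (fun a b => ‖F a b‖ ^ 2) x y)) := by
        refine mass_mono hT.connected fun x y _ => ?_
        have h0 := norm_sub_sq_le (outL T F x y) (outR T F x y)
        have h1 := norm_sq_outL_le hT hreg F x y
        have h2 := norm_sq_outR_le hT hreg F x y
        have h3 := outL_nonneg (T := T) (F := fun a b => ‖F a b‖ ^ 2) (fun _ _ => by positivity) x y
        have h4 := outR_nonneg (T := T) (F := fun a b => ‖F a b‖ ^ 2) (fun _ _ => by positivity) x y
        have h5 : (if T.dist x y = 0 then (q : ℝ) + 1 else q) ≤ q + 1 := by split_ifs <;> linarith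
        have h6 := mul_le_mul_of_nonneg_right h5 h3
        have h7 := mul_le_mul_of_nonneg_right h5 h4
        change ‖outL T F x y - outR T F x y‖ ^ 2 ≤ _
        linarith
    _ = _ := by
        rw [mass_mul_left, mass_add, mass_outR hT, mass_outL hT hfree k hinv]
        ring

/-- A kernel with the mean value property of `outL_outR_outC_outC` has masses that do not
decrease along the levels `k, k + 2, k + 4, …`, up to a factor that is only needed at level `0`. -/
theorem mass_norm_sq_le_of_outL_outR (hq : 2 ≤ q) (hT : T.IsTree)
    (hreg : T.IsRegularOfDegree (q + 1))
    (hfree : ActsFreely Γ) {Q : X → X → ℂ} (hQ : IsInvariant Γ Q)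
    (hmean : outL T (outR T Q) = (q : ℂ) • Q) (k u : ℕ) :
    mass Γ k (fun x y => ‖Q x y‖ ^ 2) ≤ 2 * mass Γ (k + 2 * u) fun x y => ‖Q x y‖ ^ 2 := by
  have hq0 : (2 : ℝ) ≤ q := by exact_mod_cast hq
  have step : ∀ k, mass Γ k (fun x y => ‖Q x y‖ ^ 2) ≤
      (if k = 0 then 2 else 1) * mass Γ (k + 2) fun x y => ‖Q x y‖ ^ 2 := by
    intro k
    have hinv := hQ.map fun z => ‖z‖ ^ 2
    rw [show k + 2 = k + 1 + 1 from rfl, ← mass_outR hT (k + 1), ← mass_outL hT hfree k hinv.outR,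
      ← mass_mul_left]
    refine mass_mono hT.connected fun x y hxy => ?_
    have h1 := norm_sq_outL_le hT hreg (outR T Q) x y
    have h2 : outL T (fun a b => ‖outR T Q a b‖ ^ 2) x y ≤
        q * outL T (outR T fun a b => ‖Q a b‖ ^ 2) x y := by
      unfold outL
      rw [Finset.mul_sum]
      refine Finset.sum_le_sum fun z hz => ?_
      rw [Finset.mem_filter] at hz
      refine (norm_sq_outR_le hT hreg Q z y).trans_eq ?_
      rw [if_neg (by omega)]
    rw [hmean, Pi.smul_apply, Pi.smul_apply, smul_eq_mul, norm_mul, mul_pow, Complex.norm_natCast,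
      hxy] at h1
    have h3 : 0 ≤ outL T (outR T fun a b => ‖Q a b‖ ^ 2) x y :=
      outL_nonneg (outR_nonneg fun _ _ => by positivity) x y
    by_cases hk : k = 0
    · rw [if_pos hk] at h1 ⊢
      have h4 := h1.trans (mul_le_mul_of_nonneg_left h2 (by positivity))
      refine le_of_mul_le_mul_left (a := (q : ℝ) ^ 2) ?_ (by positivity)
      nlinarith [mul_nonneg (mul_nonneg (by linarith : (0 : ℝ) ≤ q) h3)
        (by linarith : (0 : ℝ) ≤ q - 1)]
    · rw [if_neg hk] at h1 ⊢
      have h4 := h1.trans (mul_le_mul_of_nonneg_left h2 (by positivity))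
      refine le_of_mul_le_mul_left (a := (q : ℝ) ^ 2) ?_ (by positivity)
      nlinarith
  have step' : ∀ k u, mass Γ (k + 1) (fun x y => ‖Q x y‖ ^ 2) ≤
      mass Γ (k + 1 + 2 * u) fun x y => ‖Q x y‖ ^ 2 := by
    intro k u
    induction u with
    | zero => exact le_rfl
    | succ u ih =>
      refine ih.trans ((step _).trans_eq ?_)
      rw [if_neg (by omega), one_mul]
      rfl
  have hnn : ∀ k, 0 ≤ mass Γ k fun x y => ‖Q x y‖ ^ 2 := fun k =>
    mass_nonneg fun _ _ => by positivity
  cases k with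
  | succ k => linarith [step' k u, hnn (k + 1 + 2 * u)]
  | zero =>
    cases u with
    | zero => linarith [hnn 0]
    | succ u =>
      have h1 := step 0
      have h2 := step' 1 u
      rw [if_pos rfl] at h1
      rw [show 0 + 2 * (u + 1) = 1 + 1 + 2 * u by ring]
      linarith

/-- The second difference `outC (outC E)` is controlled by `E` at any higher level. -/
theorem mass_norm_sq_outC_outC_le (hq : 2 ≤ q) (hT : T.IsTree)
    (hreg : T.IsRegularOfDegree (q + 1)) (hfree : ActsFreely Γ) {E : X → X → ℂ}
    (hinv : IsInvariant Γ E)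
    (hE : ∀ x y, ∑ z ∈ T.neighborFinset x, E z y = ∑ z ∈ T.neighborFinset y, E x z) (k u : ℕ) :
    mass Γ k (fun x y => ‖outC T (outC T E) x y‖ ^ 2) ≤
      32 * (q + 1) ^ 2 * mass Γ (k + 2 * u + 2) fun x y => ‖E x y‖ ^ 2 := by
  have h1 := mass_norm_sq_le_of_outL_outR hq hT hreg hfree hinv.outC.outC
    (outL_outR_outC_outC T hT hreg hE) k u
  have h2 := mass_norm_sq_outC_le hT hreg hfree hinv.outC (k + 2 * u)
  have h3 := mass_norm_sq_outC_le hT hreg hfree hinv (k + 2 * u + 1)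
  have h4 : (0 : ℝ) ≤ 4 * (q + 1) := by positivity
  nlinarith [mul_le_mul_of_nonneg_left h3 h4]

/-- Averaging over the levels: the more levels are used, the smaller the second difference. -/
theorem mul_mass_norm_sq_outC_outC_le (hq : 2 ≤ q) (hT : T.IsTree)
    (hreg : T.IsRegularOfDegree (q + 1)) (hfree : ActsFreely Γ) {E : X → X → ℂ}
    (hinv : IsInvariant Γ E)
    (hE : ∀ x y, ∑ z ∈ T.neighborFinset x, E z y = ∑ z ∈ T.neighborFinset y, E x z) {k U R : ℕ}
    (hR : k + 2 * U < R) :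
    U * mass Γ k (fun x y => ‖outC T (outC T E) x y‖ ^ 2) ≤
      32 * (q + 1) ^ 2 * ∑ j ∈ Finset.range R, mass Γ j fun x y => ‖E x y‖ ^ 2 := by
  rw [← nsmul_eq_mul, ← Finset.card_range U, ← Finset.sum_const]
  refine (Finset.sum_le_sum fun u _ =>
    mass_norm_sq_outC_outC_le hq hT hreg hfree hinv hE k u).trans ?_
  rw [← Finset.mul_sum]
  refine mul_le_mul_of_nonneg_left ?_ (by positivity)
  rw [← Finset.sum_image (f := fun j => mass Γ j fun x y => ‖E x y‖ ^ 2)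
    (g := fun u => k + 2 * u + 2) (fun a _ b _ h => by simp only at h; omega)]
  refine Finset.sum_le_sum_of_subset_of_nonneg ?_ fun _ _ _ => mass_nonneg fun _ _ => by positivity
  intro j hj
  simp only [Finset.mem_image, Finset.mem_range] at hj ⊢
  obtain ⟨u, hu, rfl⟩ := hj
  omega

theorem mass_norm_sq_inC_le (hT : T.IsTree) (hfree : ActsFreely Γ)
    {E : X → X → ℂ} (hinv : IsInvariant Γ E)
    (hE : ∀ x y, ∑ z ∈ T.neighborFinset x, E z y = ∑ z ∈ T.neighborFinset y, E x z) (k : ℕ)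
    {t : ℝ} (ht : 0 < t) :
    mass Γ (k + 1) (fun x y => ‖inC T E x y‖ ^ 2) ≤ t * mass Γ k (fun x y => ‖E x y‖ ^ 2) +
      t⁻¹ * mass Γ k fun x y => ‖outC T (outC T E) x y‖ ^ 2 := by
  have hconj : IsInvariant Γ fun x y => (starRingEnd ℂ) (E x y) := hinv.map _
  -- Summation by parts turns the first difference, paired with itself, into the second one.
  have key : mass Γ (k + 1) (fun x y => (starRingEnd ℂ) (inC T E x y) * inC T E x y) =
      mass Γ k fun x y => -((starRingEnd ℂ) (E x y) * outC T (outC T E) x y) := by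
    have e1 : ∀ x y, (starRingEnd ℂ) (inC T E x y) * inC T E x y =
        inL T (fun a b => (starRingEnd ℂ) (E a b)) x y * inC T E x y -
          inR T (fun a b => (starRingEnd ℂ) (E a b)) x y * inC T E x y := fun x y => by
      rw [inL_map T hT _ (map_zero _), inR_map T hT _ (map_zero _), ← sub_mul, ← map_sub]
      rfl
    simp only [e1]
    rw [mass_sub, ← mass_outL hT hfree k (hconj.inL.map₂ hinv.inC fun a b => a * b),
      ← mass_outR hT k, ← mass_sub]
    refine mass_congr hT.connected fun x y _ => ?_
    rw [outL_inL_mul T hT, outR_inR_mul T hT, ← mul_sub, ← mul_neg]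
    congr 1
    have : outC T (outC T E) = - outC T (inC T E) := by
      rw [outC_eq_neg_inC T hT hE, ← neg_one_smul ℂ (inC T E), outC_smul, neg_one_smul]
    rw [this]
    simp [outC]
  have h1 : ((mass Γ (k + 1) fun x y => ‖inC T E x y‖ ^ 2 : ℝ) : ℂ) =
      mass Γ k fun x y => -((starRingEnd ℂ) (E x y) * outC T (outC T E) x y) := by
    rw [← key]
    unfold mass
    push_cast
    refine Finset.sum_congr rfl fun a _ => Finset.sum_congr rfl fun y _ => ?_
    rw [Complex.conj_mul']
  have h2 : mass Γ (k + 1) (fun x y => ‖inC T E x y‖ ^ 2) =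
      ‖mass Γ k fun x y => -((starRingEnd ℂ) (E x y) * outC T (outC T E) x y)‖ := by
    rw [← h1, Complex.norm_real, Real.norm_of_nonneg (mass_nonneg fun _ _ => by positivity)]
  rw [h2, ← mass_mul_left, ← mass_mul_left, ← mass_add]
  refine (norm_mass_le _ _).trans (mass_mono hT.connected fun x y _ => ?_)
  rw [norm_neg, norm_mul, Complex.norm_conj]
  have h3 : 0 ≤ t⁻¹ * (t * ‖E x y‖ - ‖outC T (outC T E) x y‖) ^ 2 := by positivity
  have h4 : t⁻¹ * (t * ‖E x y‖ - ‖outC T (outC T E) x y‖) ^ 2 = t * ‖E x y‖ ^ 2 -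
      2 * (‖E x y‖ * ‖outC T (outC T E) x y‖) + t⁻¹ * ‖outC T (outC T E) x y‖ ^ 2 := by
    field_simp
    ring
  have h5 : 0 ≤ ‖E x y‖ * ‖outC T (outC T E) x y‖ := by positivity
  linarith

end Mass

section Rigidity

variable {X : Type*} {T : SimpleGraph X} [T.LocallyFinite] {q : ℕ}

/-! ### Kernels with a small first difference are nearly constant -/

theorem sum_norm_sq_sub_average_le {ι : Type*} (s : Finset ι) (f : ι → ℂ) (D : ι → ℝ)
    (h : ∀ i ∈ s, ∀ j ∈ s, ‖f i - f j‖ ^ 2 ≤ 2 * D i + 2 * D j) :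
    ∑ i ∈ s, ‖f i - (#s : ℂ)⁻¹ * ∑ j ∈ s, f j‖ ^ 2 ≤ 4 * ∑ i ∈ s, D i := by
  rcases s.eq_empty_or_nonempty with rfl | hs
  · simp
  have hn : (0 : ℝ) < #s := by exact_mod_cast hs.card_pos
  have hn' : (#s : ℂ) ≠ 0 := by exact_mod_cast hn.ne'
  have h1 : ∀ i ∈ s, ‖f i - (#s : ℂ)⁻¹ * ∑ j ∈ s, f j‖ ^ 2 ≤
      2 * D i + (#s : ℝ)⁻¹ * (2 * ∑ j ∈ s, D j) := by
    intro i hi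
    have e1 : f i - (#s : ℂ)⁻¹ * ∑ j ∈ s, f j = (#s : ℂ)⁻¹ * ∑ j ∈ s, (f i - f j) := by
      rw [Finset.sum_sub_distrib, Finset.sum_const, nsmul_eq_mul]
      field_simp
    have e2 := norm_sq_sum_le s fun j => f i - f j
    have e3 : ∑ j ∈ s, ‖f i - f j‖ ^ 2 ≤ #s * (2 * D i) + 2 * ∑ j ∈ s, D j := by
      refine (Finset.sum_le_sum fun j hj => h i hi j hj).trans_eq ?_
      rw [Finset.sum_add_distrib, Finset.sum_const, nsmul_eq_mul, Finset.mul_sum]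
    rw [e1, norm_mul, mul_pow, norm_inv, Complex.norm_natCast]
    calc ((#s : ℝ)⁻¹) ^ 2 * ‖∑ j ∈ s, (f i - f j)‖ ^ 2
        ≤ ((#s : ℝ)⁻¹) ^ 2 * (#s * (#s * (2 * D i) + 2 * ∑ j ∈ s, D j)) := by
          refine mul_le_mul_of_nonneg_left (e2.trans ?_) (by positivity)
          exact mul_le_mul_of_nonneg_left e3 hn.le
      _ = _ := by field_simp
  refine (Finset.sum_le_sum h1).trans_eq ?_
  rw [Finset.sum_add_distrib, Finset.sum_const, nsmul_eq_mul, ← Finset.mul_sum]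
  field_simp
  ring

theorem exists_adj_dist_add_one_both (hq : 2 ≤ q) (hT : T.IsTree)
    (hreg : T.IsRegularOfDegree (q + 1)) {x y y' : X}
    (hy : T.dist x y ≠ 0) (hy' : T.dist x y' ≠ 0) :
    ∃ z, T.Adj x z ∧ T.dist z y = T.dist x y + 1 ∧ T.dist z y' = T.dist x y' + 1 := by
  classical
  obtain ⟨p, hp, hpd⟩ := exists_adj_dist_add_one hy
  obtain ⟨p', hp', hpd'⟩ := exists_adj_dist_add_one hy'
  obtain ⟨z, hz, hz'⟩ := Finset.exists_mem_notMem_of_card_lt_card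
    (s := {p, p'}) (t := T.neighborFinset x) (by
      rw [card_neighborFinset_eq_degree, hreg x]
      exact Finset.card_le_two.trans_lt (by omega))
  rw [mem_neighborFinset] at hz
  simp only [Finset.mem_insert, Finset.mem_singleton, not_or] at hz'
  refine ⟨z, hz, ?_, ?_⟩
  · have := hT.dist_eq_dist_add_one_of_adj y hz
    rw [T.dist_comm, T.dist_comm (u := y)] at this
    refine this.resolve_left fun h => hz'.1 ?_
    exact hT.eq_of_adj_of_dist_add_one hz h.symm hp hpd
  · have := hT.dist_eq_dist_add_one_of_adj y' hz
    rw [T.dist_comm, T.dist_comm (u := y')] at this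
    refine this.resolve_left fun h => hz'.2 ?_
    exact hT.eq_of_adj_of_dist_add_one hz h.symm hp' hpd'

/-- The average of a kernel over the extensions of the second end point. -/
def averageR (T : SimpleGraph X) [T.LocallyFinite] (q : ℕ) (G : X → X → ℂ) (x y : X) : ℂ :=
  (if T.dist x y = 0 then (q : ℂ) + 1 else q)⁻¹ * outR T G x y

theorem isInvariant_averageR {Γ : Subgroup (T ≃g T)} {G : X → X → ℂ} (hG : IsInvariant Γ G) :
    IsInvariant Γ (averageR T q G) := fun γ hγ x y => by
  simp only [averageR, dist_map_iso, hG.outR γ hγ]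

/-- If `y` and `y'` are two extensions of `(x, w)`, then there is a common extension `z` at the
other end, and the values at `(x, y)` and `(x, y')` are both compared to the value at `(z, w)`. -/
theorem outR_norm_sq_sub_inR_averageR_le (hq : 2 ≤ q) (hT : T.IsTree)
    (hreg : T.IsRegularOfDegree (q + 1)) (G : X → X → ℂ) (x w : X) :
    outR T (fun a b => ‖G a b - inR T (averageR T q G) a b‖ ^ 2) x w ≤
      4 * outR T (outL T fun a b => ‖inC T G a b‖ ^ 2) x w := by
  have hcard := card_out T hT hreg w x
  simp only [T.dist_comm (v := x)] at hcard
  rw [outR_apply, outR_apply]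
  have h1 : ∀ y ∈ ({y ∈ T.neighborFinset w | T.dist x y = T.dist x w + 1} : Finset X),
      inR T (averageR T q G) x y =
        (#{y ∈ T.neighborFinset w | T.dist x y = T.dist x w + 1} : ℂ)⁻¹ *
        ∑ y ∈ T.neighborFinset w with T.dist x y = T.dist x w + 1, G x y := by
    intro y hy
    rw [Finset.mem_filter, mem_neighborFinset] at hy
    rw [inR_eq T hT _ hy.1.symm hy.2.symm, averageR, outR_apply, hcard]
    push_cast
    rfl
  rw [Finset.sum_congr rfl fun y hy => by rw [h1 y hy]]
  refine sum_norm_sq_sub_average_le _ (fun y => G x y) _ fun y hy y' hy' => ?_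
  rw [Finset.mem_filter, mem_neighborFinset] at hy hy'
  obtain ⟨z, hz, hzy, hzy'⟩ := exists_adj_dist_add_one_both hq hT hreg (x := x) (y := y) (y' := y')
    (by omega) (by omega)
  have h2 : ∀ v, T.Adj w v → T.dist x v = T.dist x w + 1 → T.dist z v = T.dist x v + 1 →
      inC T G z v = G x v - G z w ∧ ‖inC T G z v‖ ^ 2 ≤
        outL T (fun a b => ‖inC T G a b‖ ^ 2) x v := by
    intro v hv hxv hzv
    have d1 := hT.connected.dist_triangle (u := z) (v := w) (w := v)
    have d2 := hT.connected.dist_triangle (u := z) (v := x) (w := w)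
    rw [dist_eq_one_iff_adj.2 hv] at d1
    rw [dist_eq_one_iff_adj.2 hz.symm] at d2
    constructor
    · rw [inC, Pi.sub_apply, Pi.sub_apply, inL_eq T hT G hz.symm hzv.symm,
        inR_eq T hT G hv.symm (by omega)]
    · refine Finset.single_le_sum (f := fun a => ‖inC T G a v‖ ^ 2) (fun _ _ => by positivity) ?_
      rw [Finset.mem_filter, mem_neighborFinset]
      exact ⟨hz, hzv⟩
  obtain ⟨e1, l1⟩ := h2 y hy.1 hy.2 hzy
  obtain ⟨e2, l2⟩ := h2 y' hy'.1 hy'.2 hzy'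
  have h3 := norm_sub_sq_le (inC T G z y) (inC T G z y')
  have e3 : G x y - G x y' = inC T G z y - inC T G z y' := by rw [e1, e2]; ring
  rw [e3]
  linarith

/-- The constants in the Poincaré inequality for kernels at level `k`, where `κ` is the constant
in the Poincaré inequality for functions on the quotient. -/
def gapConst (q : ℕ) (κ : ℝ) : ℕ → ℝ
  | 0 => κ⁻¹
  | k + 1 => 8 + 2 * (q + 1) * gapConst q κ k * (2 + 32 * q)

theorem gapConst_pos (q : ℕ) {κ : ℝ} (hκ : 0 < κ) (k : ℕ) : 0 < gapConst q κ k := by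
  induction k with
  | zero => exact inv_pos.2 hκ
  | succ k ih => simp only [gapConst]; positivity

variable {Γ : Subgroup (T ≃g T)} [Fintype (Vert Γ)]

theorem mass_succ_inR (hT : T.IsTree) (hreg : T.IsRegularOfDegree (q + 1)) (F : X → X → ℝ)
    (k : ℕ) : mass Γ (k + 1) (inR T F) = (if k = 0 then (q : ℝ) + 1 else q) * mass Γ k F := by
  rw [← mass_outR hT, ← mass_mul_left]
  refine mass_congr hT.connected fun x y hxy => ?_
  rw [outR_inR T hT hreg, hxy, nsmul_eq_mul]
  push_cast
  rfl

theorem mass_succ_inL (hT : T.IsTree) (hreg : T.IsRegularOfDegree (q + 1))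
    (hfree : ActsFreely Γ) {F : X → X → ℝ} (hF : IsInvariant Γ F) (k : ℕ) :
    mass Γ (k + 1) (inL T F) = (if k = 0 then (q : ℝ) + 1 else q) * mass Γ k F := by
  rw [← mass_outL hT hfree k hF.inL, ← mass_mul_left]
  refine mass_congr hT.connected fun x y hxy => ?_
  rw [outL_inL T hT hreg, hxy, nsmul_eq_mul]
  push_cast
  rfl

/-- Poincaré inequality for kernels at level `k`: a kernel whose value hardly changes when the
pair is shifted by one step without backtracking is close to a constant. -/
theorem exists_mass_norm_sq_sub_const_le (hq : 2 ≤ q) (hT : T.IsTree)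
    (hreg : T.IsRegularOfDegree (q + 1)) (hfree : ActsFreely Γ) {κ : ℝ} (hκ : 0 < κ)
    (hgap : ∀ g : Vert Γ → ℂ, ∃ c : ℂ, κ * ∑ a, ‖g a - c‖ ^ 2 ≤
      mass Γ 1 fun x y => ‖g (proj Γ y) - g (proj Γ x)‖ ^ 2) (k : ℕ) {G : X → X → ℂ}
    (hG : IsInvariant Γ G) :
    ∃ c : ℂ, mass Γ k (fun x y => ‖G x y - c‖ ^ 2) ≤
      gapConst q κ k * mass Γ (k + 1) fun x y => ‖inC T G x y‖ ^ 2 := by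
  induction k generalizing G with
  | zero =>
    obtain ⟨c, hc⟩ := hgap fun a => G (rep Γ a) (rep Γ a)
    refine ⟨c, ?_⟩
    have hdiag : ∀ x, G (rep Γ (proj Γ x)) (rep Γ (proj Γ x)) = G x x := fun x => by
      obtain ⟨γ, hγ, h⟩ := (proj_eq_iff Γ).1 (proj_rep Γ (proj Γ x)).symm
      rw [← h, hG γ hγ]
    have e1 : mass Γ 0 (fun x y => ‖G x y - c‖ ^ 2) =
        ∑ a, ‖G (rep Γ a) (rep Γ a) - c‖ ^ 2 := by simp [mass, sphere]
    have e2 : mass Γ (0 + 1) (fun x y => ‖inC T G x y‖ ^ 2) = mass Γ 1 fun x y =>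
        ‖G (rep Γ (proj Γ y)) (rep Γ (proj Γ y)) -
          G (rep Γ (proj Γ x)) (rep Γ (proj Γ x))‖ ^ 2 := by
      refine mass_congr hT.connected fun x y hxy => ?_
      have hadj := dist_eq_one_iff_adj.1 hxy
      rw [hdiag, hdiag, inC, Pi.sub_apply, Pi.sub_apply,
        inL_eq T hT G hadj (by rw [dist_self, hxy]),
        inR_eq T hT G hadj.symm (by rw [dist_self, hxy])]
    rw [e1, e2, gapConst, ← div_eq_inv_mul, le_div_iff₀' hκ]
    exact hc
  | succ k ih =>
    have hG' := isInvariant_averageR (q := q) hG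
    obtain ⟨c, hc⟩ := ih hG'
    refine ⟨c, ?_⟩
    have hq0 : (2 : ℝ) ≤ q := by exact_mod_cast hq
    set G' := averageR T q G with hG'def
    set D : ℝ := mass Γ (k + 1 + 1) fun x y => ‖inC T G x y‖ ^ 2 with hD
    have hinvD : IsInvariant Γ fun x y => ‖inC T G x y‖ ^ 2 := hG.inC.map fun z => ‖z‖ ^ 2
    -- `G` is close to a kernel that does not depend on the last step of the path.
    have h1 : mass Γ (k + 1) (fun x y => ‖G x y - inR T G' x y‖ ^ 2) ≤ 4 * D := by
      rw [hD, ← mass_outL hT hfree (k + 1) hinvD, ← mass_outR hT, ← mass_outR hT, ← mass_mul_left]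
      exact mass_mono hT.connected fun x y _ => outR_norm_sq_sub_inR_averageR_le hq hT hreg G x y
    have h2 : mass Γ (k + 1 + 1) (fun x y => ‖inC T (G - inR T G') x y‖ ^ 2) ≤ 16 * q * D := by
      have hinv : IsInvariant Γ fun x y => ‖G x y - inR T G' x y‖ ^ 2 :=
        hG.map₂ hG'.inR fun a b => ‖a - b‖ ^ 2
      calc _ ≤ mass Γ (k + 1 + 1) (fun x y =>
              2 * (inL T (fun x y => ‖G x y - inR T G' x y‖ ^ 2) x y +
                inR T (fun x y => ‖G x y - inR T G' x y‖ ^ 2) x y)) := by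
            refine mass_mono hT.connected fun x y _ => ?_
            have e1 := inL_map T hT (fun z : ℂ => ‖z‖ ^ 2) (by simp) (G - inR T G') x y
            have e2 := inR_map T hT (fun z : ℂ => ‖z‖ ^ 2) (by simp) (G - inR T G') x y
            simp only [Pi.sub_apply] at e1 e2
            rw [e1, e2, mul_add]
            exact norm_sub_sq_le _ _
        _ = 4 * q * mass Γ (k + 1) (fun x y => ‖G x y - inR T G' x y‖ ^ 2) := by
            rw [mass_mul_left, mass_add, mass_succ_inL hT hreg hfree hinv,
              mass_succ_inR hT hreg, if_neg (by omega)]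
            ring
        _ ≤ _ := by nlinarith
    have h3 : mass Γ (k + 1) (fun x y => ‖inC T G' x y‖ ^ 2) ≤ (2 + 32 * q) * D := by
      have e0 : 0 ≤ mass Γ (k + 1) fun x y => ‖inC T G' x y‖ ^ 2 :=
        mass_nonneg fun _ _ => by positivity
      have e1 := mass_succ_inR (Γ := Γ) hT hreg (fun x y => ‖inC T G' x y‖ ^ 2) (k + 1)
      rw [if_neg (by omega)] at e1
      have e2 : inR T (inC T G') = inC T G - inC T (G - inR T G') := by
        rw [inC_sub, sub_sub_cancel]
        unfold inC
        rw [inR_sub, ← inL_inR T hT.connected]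
      have e3 : mass Γ (k + 1 + 1) (inR T fun x y => ‖inC T G' x y‖ ^ 2) ≤
          2 * D + 2 * mass Γ (k + 1 + 1) (fun x y => ‖inC T (G - inR T G') x y‖ ^ 2) := by
        rw [hD, ← mass_mul_left, ← mass_mul_left, ← mass_add]
        refine mass_mono hT.connected fun x y _ => ?_
        rw [inR_map T hT (fun z : ℂ => ‖z‖ ^ 2) (by simp) (inC T G') x y, e2]
        exact norm_sub_sq_le _ _
      nlinarith
    have h4 : mass Γ (k + 1) (fun x y => ‖G x y - c‖ ^ 2) ≤
        2 * mass Γ (k + 1) (fun x y => ‖G x y - inR T G' x y‖ ^ 2) +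
          2 * mass Γ (k + 1) (inR T fun x y => ‖G' x y - c‖ ^ 2) := by
      rw [← mass_mul_left, ← mass_mul_left, ← mass_add]
      refine mass_mono hT.connected fun x y hxy => ?_
      obtain ⟨z, hz, hd⟩ := exists_adj_dist_add_one (G := T) (x := y) (y := x)
        (by rw [T.dist_comm, hxy]; omega)
      rw [T.dist_comm, T.dist_comm (u := y)] at hd
      rw [inR_eq T hT G' hz hd, inR_eq T hT (fun x y => ‖G' x y - c‖ ^ 2) hz hd]
      have := norm_sub_sq_le (G x y - G' x z) (-(G' x z - c))
      rw [norm_neg, sub_neg_eq_add, sub_add_sub_cancel] at this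
      exact this
    have h5 : mass Γ (k + 1) (inR T fun x y => ‖G' x y - c‖ ^ 2) ≤
        (q + 1) * mass Γ k fun x y => ‖G' x y - c‖ ^ 2 := by
      rw [mass_succ_inR hT hreg]
      refine mul_le_mul_of_nonneg_right ?_ (mass_nonneg fun _ _ => by positivity)
      split_ifs <;> linarith
    have h6 : (q + 1 : ℝ) * mass Γ k (fun x y => ‖G' x y - c‖ ^ 2) ≤
        (q + 1) * (gapConst q κ k * ((2 + 32 * q) * D)) := by
      refine mul_le_mul_of_nonneg_left (hc.trans ?_) (by positivity)
      exact mul_le_mul_of_nonneg_left h3 (gapConst_pos q hκ k).le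
    simp only [gapConst]
    linarith

end Rigidity

section Spectral

variable {X : Type*} {T : SimpleGraph X} [T.LocallyFinite] {q : ℕ}
variable {Γ : Subgroup (T ≃g T)} [Fintype (Vert Γ)]

/-! ### The Poincaré inequality on the quotient -/

theorem sphere_one (hT : T.Connected) (x : X) : sphere T x 1 = T.neighborFinset x := by
  ext y
  rw [mem_sphere hT, dist_eq_one_iff_adj, mem_neighborFinset]

theorem adjOp_apply_proj (f : EuclideanSpace ℂ (Vert Γ)) (x : X) :
    adjOp Γ f (proj Γ x) = ∑ y ∈ T.neighborFinset x, f (proj Γ y) := rfl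

theorem sum_neighborFinset_eigenvector {f : EuclideanSpace ℂ (Vert Γ)} {l : ℝ}
    (hf : adjOp Γ f = (l : ℂ) • f) (x : X) :
    ∑ y ∈ T.neighborFinset x, f (proj Γ y) = l * f (proj Γ x) := by
  rw [← adjOp_apply_proj, hf]
  rfl

theorem mass_proj_left (hT : T.IsTree) (hreg : T.IsRegularOfDegree (q + 1)) (k : ℕ)
    (f : Vert Γ → ℝ) : mass Γ k (fun x _ => f (proj Γ x)) = sphereCard q k * ∑ a, f a := by
  simp only [mass, Finset.sum_const, card_sphere hT hreg, proj_rep, nsmul_eq_mul, Finset.mul_sum]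

theorem mass_proj_right (hT : T.IsTree) (hreg : T.IsRegularOfDegree (q + 1))
    (hfree : ActsFreely Γ) (k : ℕ) (f : Vert Γ → ℝ) :
    mass Γ k (fun _ y => f (proj Γ y)) = sphereCard q k * ∑ a, f a := by
  rw [← mass_proj_left hT hreg]
  exact mass_flip hT.connected hfree k (isInvariant_proj fun a _ => f a)

/-- The Dirichlet form of the quotient graph. -/
theorem mass_one_norm_sq_sub (hT : T.IsTree) (hreg : T.IsRegularOfDegree (q + 1))
    (hfree : ActsFreely Γ) (g : EuclideanSpace ℂ (Vert Γ)) :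
    mass Γ 1 (fun x y => ‖g (proj Γ y) - g (proj Γ x)‖ ^ 2) =
      2 * (q + 1) * ‖g‖ ^ 2 - 2 * (inner ℂ g (adjOp Γ g)).re := by
  have h1 : (inner ℂ g (adjOp Γ g)).re =
      mass Γ 1 fun x y => (inner ℂ (g (proj Γ x)) (g (proj Γ y))).re := by
    simp only [PiLp.inner_apply, Complex.re_sum, mass, sphere_one hT.connected, proj_rep]
    refine Finset.sum_congr rfl fun a _ => ?_
    rw [← Complex.re_sum, ← inner_sum, ← adjOp_apply_proj, proj_rep]
  have h2 : ∀ x y, ‖g (proj Γ y) - g (proj Γ x)‖ ^ 2 = ‖g (proj Γ y)‖ ^ 2 + ‖g (proj Γ x)‖ ^ 2 -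
      2 * (inner ℂ (g (proj Γ x)) (g (proj Γ y))).re := fun x y => by
    rw [norm_sub_rev, @norm_sub_sq ℂ]
    simp only [RCLike.re_to_complex]
    ring
  simp only [h2]
  rw [mass_sub, mass_add, mass_mul_left, ← h1,
    mass_proj_right hT hreg hfree 1 fun a => ‖g a‖ ^ 2, mass_proj_left hT hreg 1 fun a => ‖g a‖ ^ 2,
    EuclideanSpace.norm_sq_eq]
  simp only [sphereCard]
  push_cast
  ring

theorem eq_of_mass_one_eq_zero (hT : T.IsTree) {f : Vert Γ → ℂ}
    (h : mass Γ 1 (fun x y => ‖f (proj Γ y) - f (proj Γ x)‖ ^ 2) = 0) (a b : Vert Γ) :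
    f a = f b := by
  have h1 : ∀ x y, T.Adj x y → f (proj Γ x) = f (proj Γ y) := by
    intro x y hxy
    obtain ⟨γ, hγ, hx⟩ := (proj_eq_iff Γ).1 (proj_rep Γ (proj Γ x)).symm
    have h2 := (Finset.sum_eq_zero_iff_of_nonneg fun a _ => Finset.sum_nonneg fun y _ =>
      sq_nonneg ‖f (proj Γ y) - f (proj Γ (rep Γ a))‖).1 h (proj Γ x) (Finset.mem_univ _)
    have h3 := (Finset.sum_eq_zero_iff_of_nonneg fun y _ => sq_nonneg _).1 h2 (γ y) (by
      rw [mem_sphere hT.connected, ← hx, dist_map_iso]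
      exact dist_eq_one_iff_adj.2 hxy)
    simp only [proj_rep, proj_apply Γ hγ] at h3
    have h4 := norm_eq_zero.1 (pow_eq_zero_iff (two_ne_zero) |>.1 h3)
    exact (sub_eq_zero.1 h4).symm
  obtain ⟨p⟩ := hT.connected (rep Γ a) (rep Γ b)
  have h2 : ∀ {x y : X} (_ : T.Walk x y), f (proj Γ x) = f (proj Γ y) := by
    intro x y p
    induction p with
    | nil => rfl
    | cons hadj _ ih => exact (h1 _ _ hadj).trans ih
  simpa only [proj_rep] using h2 p

variable {ι : Type*} [Fintype ι]

theorem inner_adjOp_eigenbasis {lam : ι → ℝ} {ψ : OrthonormalBasis ι ℂ (EuclideanSpace ℂ (Vert Γ))}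
    (hψ : ∀ j, adjOp Γ (ψ j) = (lam j : ℂ) • ψ j) (g : EuclideanSpace ℂ (Vert Γ)) :
    (inner ℂ g (adjOp Γ g)).re = ∑ j, lam j * ‖inner ℂ (ψ j) g‖ ^ 2 := by
  have h1 : adjOp Γ g = ∑ j, (inner ℂ (ψ j) g * lam j) • ψ j := by
    conv_lhs => rw [← ψ.sum_repr' g]
    rw [map_sum]
    refine Finset.sum_congr rfl fun j _ => ?_
    rw [map_smul, hψ, smul_smul]
  rw [h1, inner_sum, Complex.re_sum]
  refine Finset.sum_congr rfl fun j _ => ?_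
  rw [inner_smul_right, ← inner_conj_symm g (ψ j), mul_right_comm, Complex.mul_conj,
    Complex.normSq_eq_norm_sq, ← Complex.ofReal_mul, Complex.ofReal_re, mul_comm]

/-- Poincaré inequality on the quotient. The constant is the value of the projection of `g` to the
eigenspace of the largest eigenvalue `q + 1`, which consists of constant functions. -/
theorem exists_gap (hT : T.IsTree) (hreg : T.IsRegularOfDegree (q + 1)) (hfree : ActsFreely Γ)
    {lam : ι → ℝ} {ψ : OrthonormalBasis ι ℂ (EuclideanSpace ℂ (Vert Γ))}
    (hψ : ∀ j, adjOp Γ (ψ j) = (lam j : ℂ) • ψ j) {β : ℝ}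
    (hlam : ∀ j, lam j = q + 1 ∨ lam j ≤ (q + 1) * (1 - β)) (g : Vert Γ → ℂ) :
    ∃ c : ℂ, 2 * (q + 1) * β * ∑ a, ‖g a - c‖ ^ 2 ≤
      mass Γ 1 fun x y => ‖g (proj Γ y) - g (proj Γ x)‖ ^ 2 := by
  classical
  obtain ⟨x₀⟩ := hT.connected.nonempty
  set G : EuclideanSpace ℂ (Vert Γ) := WithLp.toLp 2 g with hG
  have hform : ∀ f : EuclideanSpace ℂ (Vert Γ),
      mass Γ 1 (fun x y => ‖f (proj Γ y) - f (proj Γ x)‖ ^ 2) =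
        2 * ∑ j, (q + 1 - lam j) * ‖inner ℂ (ψ j) f‖ ^ 2 := fun f => by
    rw [mass_one_norm_sq_sub hT hreg hfree, inner_adjOp_eigenbasis hψ,
      ← ψ.sum_sq_norm_inner_right f, Finset.mul_sum, Finset.mul_sum, Finset.mul_sum,
      ← Finset.sum_sub_distrib]
    exact Finset.sum_congr rfl fun j _ => by ring
  -- Eigenfunctions with the largest eigenvalue have no Dirichlet energy, hence are constant.
  have hconst : ∀ j, lam j = q + 1 → ∀ a b, ψ j a = ψ j b := by
    intro j hj
    refine eq_of_mass_one_eq_zero hT ?_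
    rw [hform, mul_eq_zero]
    refine Or.inr (Finset.sum_eq_zero fun i _ => ?_)
    rw [ψ.inner_eq_ite]
    split_ifs with h
    · rw [h, hj]; ring
    · simp
  set H : EuclideanSpace ℂ (Vert Γ) :=
    ∑ j with lam j = q + 1, (inner ℂ (ψ j) G) • ψ j with hH
  have hHconst : ∀ a, H a = H (proj Γ x₀) := by
    intro a
    rw [hH]
    simp only [WithLp.ofLp_sum, WithLp.ofLp_smul, Finset.sum_apply, Pi.smul_apply]
    refine Finset.sum_congr rfl fun j hj => ?_
    rw [hconst j (Finset.mem_filter.1 hj).2 a (proj Γ x₀)]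
  refine ⟨H (proj Γ x₀), ?_⟩
  have hnorm : ∑ a, ‖g a - H (proj Γ x₀)‖ ^ 2 = ‖G - H‖ ^ 2 := by
    rw [EuclideanSpace.norm_sq_eq]
    refine Finset.sum_congr rfl fun a _ => ?_
    rw [← hHconst a]
    rfl
  have hinner : ∀ i, inner ℂ (ψ i) (G - H) = if lam i = q + 1 then 0 else inner ℂ (ψ i) G := by
    intro i
    rw [inner_sub_right, hH, inner_sum]
    simp only [inner_smul_right, ψ.inner_eq_ite, mul_ite, mul_one, mul_zero]
    rw [Finset.sum_ite_eq]
    simp only [Finset.mem_filter, Finset.mem_univ, true_and]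
    split_ifs <;> simp
  rw [hnorm, hform G, ← ψ.sum_sq_norm_inner_right (G - H), Finset.mul_sum, Finset.mul_sum]
  refine Finset.sum_le_sum fun j _ => ?_
  rw [hinner]
  split_ifs with h
  · rw [h]; simp
  · have := (hlam j).resolve_left h
    nlinarith [mul_le_mul_of_nonneg_right (by linarith : (q + 1) * β ≤ q + 1 - lam j)
      (sq_nonneg ‖inner ℂ (ψ j) G‖)]

theorem eigenvalue_le_of_spectrum {β : ℝ}
    (hspec : spectrum ℂ (((q : ℂ) + 1)⁻¹ • adjOp Γ) ⊆
      (fun t : ℝ => (t : ℂ)) '' ({1} ∪ Set.Icc (-1 + β) (1 - β)))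
    {f : EuclideanSpace ℂ (Vert Γ)} (hf0 : f ≠ 0) {l : ℝ} (hf : adjOp Γ f = (l : ℂ) • f) :
    l = q + 1 ∨ l ≤ (q + 1) * (1 - β) := by
  have hq : (0 : ℝ) < q + 1 := by positivity
  have h1 : Module.End.HasEigenvalue (((q : ℂ) + 1)⁻¹ • adjOp Γ :
      Module.End ℂ (EuclideanSpace ℂ (Vert Γ))) (((q : ℂ) + 1)⁻¹ * l) := by
    refine Module.End.hasEigenvalue_of_hasEigenvector (x := f)
      ⟨Module.End.mem_eigenspace_iff.2 ?_, hf0⟩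
    rw [LinearMap.smul_apply, hf, smul_smul]
  obtain ⟨t, ht, h2⟩ := hspec h1.mem_spectrum
  have h3 : t = (q + 1 : ℝ)⁻¹ * l := by
    have : (t : ℂ) = (((q + 1 : ℝ)⁻¹ * l : ℝ) : ℂ) := by
      push_cast
      exact h2
    exact_mod_cast this
  have h4 : l = (q + 1) * t := by rw [h3]; field_simp
  rcases ht with ht | ht
  · left; rw [h4, Set.mem_singleton_iff.1 ht, mul_one]
  · right; rw [h4]; exact mul_le_mul_of_nonneg_left ht.2 hq.le

/-! ### Sums of eigenfunctions over spheres -/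

theorem spherical_eq_chebyshev (hq : 2 ≤ q) (l : ℝ) (d : ℕ) :
    spherical q l d = ((Real.sqrt q : ℂ)⁻¹) ^ d *
      (2 / ((q : ℂ) + 1) *
          (Polynomial.Chebyshev.T ℂ d).eval ((l : ℂ) / (2 * (Real.sqrt q : ℂ))) +
        ((q : ℂ) - 1) / ((q : ℂ) + 1) *
          (Polynomial.Chebyshev.U ℂ d).eval ((l : ℂ) / (2 * (Real.sqrt q : ℂ)))) := by
  obtain ⟨s, hs⟩ := exists_isSpectralParameter hq l
  rw [spherical_eq hq hs, sphericalOfParameter_eq hq hs]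
  congr 1
  have h : (q : ℝ) ^ (-(d : ℝ) / 2) = (Real.sqrt q)⁻¹ ^ d := by
    rw [inv_pow, Real.sqrt_eq_rpow, ← Real.rpow_natCast, ← Real.rpow_mul (by positivity),
      ← Real.rpow_neg (by positivity)]
    congr 1
    ring
  rw [h]
  push_cast
  rfl

theorem sqrt_ne_zero (hq : 2 ≤ q) : (Real.sqrt q : ℂ) ≠ 0 := by
  have : (0 : ℝ) < q := by exact_mod_cast (by omega : 0 < q)
  exact_mod_cast (Real.sqrt_pos.2 this).ne'

theorem sqrt_mul_sqrt : (Real.sqrt q : ℂ) * Real.sqrt q = q := by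
  rw [← Complex.ofReal_mul, Real.mul_self_sqrt (Nat.cast_nonneg q), Complex.ofReal_natCast]

theorem spherical_zero (hq : 2 ≤ q) (l : ℝ) : spherical q l 0 = 1 := by
  have : (q : ℂ) + 1 ≠ 0 := by exact_mod_cast Nat.succ_ne_zero q
  rw [spherical_eq_chebyshev hq]
  simp
  field_simp
  ring

theorem spherical_one (hq : 2 ≤ q) (l : ℝ) : ((q : ℂ) + 1) * spherical q l 1 = l := by
  have h1 : (q : ℂ) + 1 ≠ 0 := by exact_mod_cast Nat.succ_ne_zero q
  have h2 := sqrt_ne_zero hq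
  have h3 := sqrt_mul_sqrt (q := q)
  rw [spherical_eq_chebyshev hq]
  simp
  field_simp
  linear_combination (-(l : ℂ)) * h3

theorem spherical_add_two (hq : 2 ≤ q) (l : ℝ) (k : ℕ) :
    (q : ℂ) * spherical q l (k + 2) = l * spherical q l (k + 1) - spherical q l k := by
  have h2 := sqrt_ne_zero hq
  have h3 := sqrt_mul_sqrt (q := q)
  simp only [spherical_eq_chebyshev hq]
  push_cast
  rw [Polynomial.Chebyshev.T_add_two, Polynomial.Chebyshev.U_add_two]
  simp only [Polynomial.eval_sub, Polynomial.eval_mul, Polynomial.eval_ofNat, Polynomial.eval_X]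
  rw [← h3, pow_add, pow_add]
  field_simp
  ring

/-- The value at `x` determines the sum of an eigenfunction over every sphere about `x`. -/
theorem sum_sphere_eigenfunction (hq : 2 ≤ q) (hT : T.IsTree)
    (hreg : T.IsRegularOfDegree (q + 1)) {f : X → ℂ} {l : ℝ}
    (hf : ∀ x, ∑ y ∈ T.neighborFinset x, f y = l * f x) (x : X) (k : ℕ) :
    ∑ y ∈ sphere T x k, f y = sphereCard q k * spherical q l k * f x := by
  set F : X → X → ℂ := fun _ y => f y with hF
  have h1 : ∀ k, (l : ℂ) * ∑ y ∈ sphere T x k, f y =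
      ∑ y ∈ sphere T x (k + 1), f y + ∑ y ∈ sphere T x k, inR T F x y := by
    intro k
    rw [← sum_sphere_outR hT F, ← Finset.sum_add_distrib, Finset.mul_sum]
    refine Finset.sum_congr rfl fun y _ => ?_
    rw [outR_add_inR T hT, ← hf y]
  have h2 : ∀ k, ∑ y ∈ sphere T x (k + 1), inR T F x y =
      (if k = 0 then (q : ℂ) + 1 else q) * ∑ y ∈ sphere T x k, f y := by
    intro k
    rw [← sum_sphere_outR hT, Finset.mul_sum]
    refine Finset.sum_congr rfl fun y hy => ?_
    rw [mem_sphere hT.connected] at hy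
    rw [outR_inR T hT hreg, hy, nsmul_eq_mul]
    push_cast
    rfl
  have h0 : ∑ y ∈ sphere T x 0, f y = f x := by simp [sphere]
  have hone : ∑ y ∈ sphere T x 1, f y = l * f x := by
    rw [sphere_one hT.connected, hf]
  induction k using Nat.strong_induction_on with
  | _ k ih =>
    match k with
    | 0 => rw [h0, spherical_zero hq]; simp [sphereCard]
    | 1 =>
      rw [hone, ← spherical_one hq l]
      simp [sphereCard]
    | k + 2 =>
      have e1 := h1 (k + 1)
      rw [h2, ih (k + 1) (by omega), ih k (by omega)] at e1
      have e2 := spherical_add_two hq l k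
      rw [show k + 2 = k + 1 + 1 from rfl, ← sub_eq_iff_eq_add.2 e1]
      rw [show k + 1 + 1 = k + 2 from rfl]
      cases k with
      | zero =>
        simp only [sphereCard, if_pos]
        push_cast
        linear_combination (-((q : ℂ) + 1) * f x) * e2
      | succ k =>
        rw [if_neg (by omega)]
        simp only [sphereCard]
        push_cast
        linear_combination (-((q : ℂ) + 1) * q ^ (k + 1) * f x) * e2

end Spectral

section Geometry

variable {X : Type*} {T : SimpleGraph X} {Γ : Subgroup (T ≃g T)}

/-! ### Distances in the quotient, and balls that are trees -/

theorem underlyingGraph_reachable_and_qdist_le (hT : T.Connected) (x y : X) :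
    (underlyingGraph Γ).Reachable (proj Γ x) (proj Γ y) ∧
      qdist Γ (proj Γ x) (proj Γ y) ≤ T.dist x y := by
  have key : ∀ {x y : X} (p : T.Walk x y),
      ∃ w : (underlyingGraph Γ).Walk (proj Γ x) (proj Γ y), w.length ≤ p.length := by
    intro x y p
    induction p with
    | nil => exact ⟨Walk.nil, le_rfl⟩
    | @cons u v w h p ih =>
      obtain ⟨p', hp'⟩ := ih
      by_cases huv : proj Γ u = proj Γ v
      · exact ⟨p'.copy huv.symm rfl, by rw [Walk.length_copy, Walk.length_cons]; omega⟩
      · have hadj : (underlyingGraph Γ).Adj (proj Γ u) (proj Γ v) := ⟨huv, u, v, h, rfl, rfl⟩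
        exact ⟨Walk.cons hadj p', by rw [Walk.length_cons, Walk.length_cons]; omega⟩
  obtain ⟨p, hp⟩ := hT.exists_walk_length_eq_dist x y
  obtain ⟨w, hw⟩ := key p
  exact ⟨⟨w⟩, (dist_le w).trans (hw.trans hp.le)⟩

/-- Walks of the quotient can be lifted to the tree, with a prescribed starting point. -/
theorem exists_walk_lift {a b : Vert Γ} (w : (underlyingGraph Γ).Walk a b) (x : X)
    (hx : proj Γ x = a) : ∃ y, proj Γ y = b ∧ ∃ p : T.Walk x y, p.length = w.length := by
  induction w generalizing x with
  | nil => exact ⟨x, hx, Walk.nil, rfl⟩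
  | cons h w ih =>
    obtain ⟨_, u, v, huv, hu, hv⟩ := h
    obtain ⟨γ, hγ, hux⟩ := (proj_eq_iff Γ).1 (hu.trans hx.symm)
    obtain ⟨y, hy, p, hp⟩ := ih (γ v) ((proj_apply Γ hγ v).trans hv)
    have hadj : T.Adj x (γ v) := by rw [← hux]; exact γ.map_adj_iff.2 huv
    exact ⟨y, hy, Walk.cons hadj p, congrArg (· + 1) hp⟩

/-- Every vertex of the quotient has a lift that realizes its distance. -/
theorem exists_dist_eq_qdist (hT : T.Connected) (x : X) (b : Vert Γ) :
    ∃ y, proj Γ y = b ∧ T.dist x y = qdist Γ (proj Γ x) b := by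
  have h0 := (underlyingGraph_reachable_and_qdist_le (Γ := Γ) hT x (rep Γ b)).1
  rw [proj_rep] at h0
  obtain ⟨w, hw⟩ := h0.exists_walk_length_eq_dist
  obtain ⟨y, hy, p, hp⟩ := exists_walk_lift w x rfl
  refine ⟨y, hy, le_antisymm ?_ ?_⟩
  · exact (dist_le p).trans (hp.trans hw).le
  · rw [← hy]
    exact (underlyingGraph_reachable_and_qdist_le hT x y).2

/-- If a ball of the quotient is a tree, then the projection is injective on the ball of the same
radius of the tree. -/
theorem BallIsTree.proj_injOn (hT : T.IsTree) (hfree : ActsFreely Γ) {x : X} {r : ℕ}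
    (h : BallIsTree Γ (proj Γ x) r) {y y' : X} (hy : T.dist x y ≤ r) (hy' : T.dist x y' ≤ r)
    (hyy' : proj Γ y = proj Γ y') : y = y' := by
  have hc := hT.connected
  set H := (underlyingGraph Γ).induce (qball Γ (proj Γ x) r) with hH
  have hball : ∀ y, T.dist x y ≤ r → proj Γ y ∈ qball Γ (proj Γ x) r := fun y hy =>
    (underlyingGraph_reachable_and_qdist_le hc x y).2.trans hy
  let v : ∀ y, T.dist x y ≤ r → qball Γ (proj Γ x) r := fun y hy => ⟨proj Γ y, hball y hy⟩
  let v₀ := v x (by simp)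
  have hadj : ∀ y z (hy : T.dist x y ≤ r) (hz : T.dist x z ≤ r), T.Adj y z →
      H.Adj (v y hy) (v z hz) := fun y z hy hz hyz =>
    ⟨h.no_loop y z hyz (hball y hy), y, z, hyz, rfl, rfl⟩
  -- Two edges of the tree with one end in common and the same projection coincide.
  have hedge : ∀ w y z, T.dist x w ≤ r → T.dist x y ≤ r → T.Adj w y → T.Adj w z →
      proj Γ y = proj Γ z → y = z := by
    intro w y z hw hy hwy hwz hyz
    obtain ⟨γ, hγ, h1, h2⟩ := h.no_multiple_edge w y w z hwy hwz (hball w hw) (hball y hy) rfl hyz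
    rw [eq_one_of_apply_eq hfree hγ h1] at h2
    exact h2
  have hpred : ∀ y, T.dist x y ≠ 0 → ∃ w, T.Adj y w ∧ T.dist x w + 1 = T.dist x y := by
    intro y hy
    rw [T.dist_comm] at hy
    obtain ⟨w, hw, hd⟩ := exists_adj_dist_add_one hy
    rw [T.dist_comm, T.dist_comm (u := y)] at hd
    exact ⟨w, hw, hd⟩
  -- The projection preserves the distance to the centre, measured inside the ball.
  have hdist : ∀ n y (hy : T.dist x y ≤ r), T.dist x y = n → H.dist (v y hy) v₀ = n := by
    intro n
    induction n using Nat.strong_induction_on with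
    | _ n ih =>
      intro y hy hyn
      rcases Nat.eq_zero_or_pos n with rfl | hn
      · have : x = y := hc.dist_eq_zero_iff.1 hyn
        subst this
        exact dist_self
      obtain ⟨w, hw, hwd⟩ := hpred y (by omega)
      have hwr : T.dist x w ≤ r := by omega
      have e1 := ih (n - 1) (by omega) w hwr (by omega)
      have hwy := hadj w y hwr hy hw.symm
      have e2 := h.isTree.dist_eq_dist_add_one_of_adj v₀ hwy
      rw [H.dist_comm, H.dist_comm (u := v₀), e1] at e2
      rcases e2 with e2 | e2
      · exfalso
        obtain ⟨u, hu, hud⟩ := hpred w (by rw [← H.dist_comm] at e2; omega)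
        have hur : T.dist x u ≤ r := by omega
        have e3 := ih (n - 2) (by omega) u hur (by omega)
        have e4 := h.isTree.eq_of_adj_of_dist_add_one hwy (by rw [e1, e2])
          (hadj w u hwr hur hu) (by rw [e1, e3]; omega)
        have e5 := hedge w y u hwr hy hw.symm hu (congrArg Subtype.val e4)
        rw [e5] at hwd
        omega
      · rw [e2]; omega
  have hinj : ∀ n y y' (hy : T.dist x y ≤ r) (hy' : T.dist x y' ≤ r), T.dist x y = n →
      T.dist x y' = n → proj Γ y = proj Γ y' → y = y' := by
    intro n
    induction n with
    | zero =>
      intro y y' _ _ e e' _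
      rw [← hc.dist_eq_zero_iff.1 e, ← hc.dist_eq_zero_iff.1 e']
    | succ n ih =>
      intro y y' hy hy' e e' hyy'
      obtain ⟨w, hw, hwd⟩ := hpred y (by omega)
      obtain ⟨w', hw', hwd'⟩ := hpred y' (by omega)
      have hwr : T.dist x w ≤ r := by omega
      have hwr' : T.dist x w' ≤ r := by omega
      have hv : v y hy = v y' hy' := Subtype.ext hyy'
      have e1 := h.isTree.eq_of_adj_of_dist_add_one (hadj y w hy hwr hw)
        (by rw [hdist n w hwr (by omega), hdist (n + 1) y hy e]) (y := v₀)
        (hv ▸ hadj y' w' hy' hwr' hw')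
        (by rw [hdist n w' hwr' (by omega), hdist (n + 1) y hy e])
      have e2 := ih w w' hwr hwr' (by omega) (by omega) (congrArg Subtype.val e1)
      subst e2
      exact hedge w y y' hwr hy hw.symm hw'.symm hyy'
  have e : T.dist x y = T.dist x y' := by
    rw [← hdist _ y hy rfl, ← hdist _ y' hy' rfl]
    congr 1
    exact Subtype.ext hyy'
  exact hinj _ y y' hy hy' e rfl hyy'

theorem exists_ballIsTree_of_le_injRadius {a : Vert Γ} {R : ℕ} (h : (R + 1 : ℕ) ≤ injRadius Γ a) :
    ∃ r, R ≤ r ∧ BallIsTree Γ a r := by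
  have h1 : (R : ℕ∞) < injRadius Γ a :=
    lt_of_lt_of_le (by exact_mod_cast Nat.lt_succ_self R) h
  unfold injRadius at h1
  obtain ⟨r, hr⟩ := lt_iSup_iff.1 h1
  obtain ⟨hb, hr⟩ := lt_iSup_iff.1 hr
  exact ⟨r, by exact_mod_cast hr.le, hb⟩

theorem card_vert_pos [Fintype (Vert Γ)] (hT : T.Connected) : 0 < Fintype.card (Vert Γ) := by
  obtain ⟨x⟩ := hT.nonempty
  exact Fintype.card_pos_iff.2 ⟨proj Γ x⟩

theorem card_mul_sphereCard_pos [Fintype (Vert Γ)] {q : ℕ} (hq : 2 ≤ q) (hT : T.Connected) (k : ℕ) :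
    (0 : ℝ) < (Fintype.card (Vert Γ) : ℝ) * sphereCard q k :=
  mul_pos (by exact_mod_cast card_vert_pos hT) (by exact_mod_cast sphereCard_pos hq k)

end Geometry

section Lift

variable {X : Type*} {T : SimpleGraph X} [T.LocallyFinite] {q : ℕ}
variable {Γ : Subgroup (T ≃g T)}

/-! ### Lifting a matrix on the quotient to a kernel on the tree -/

open Classical in
/-- The lift of a matrix on the quotient to a kernel on the tree. An entry at quotient distance
`k` is distributed evenly over the pairs of lifts at distance exactly `k`. -/
def liftKernel (Γ : Subgroup (T ≃g T)) (K : Vert Γ → Vert Γ → ℂ) (x y : X) : ℂ :=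
  if T.dist x y = qdist Γ (proj Γ x) (proj Γ y) then
    (#{z ∈ sphere T x (T.dist x y) | proj Γ z = proj Γ y} : ℂ)⁻¹ * K (proj Γ x) (proj Γ y)
  else 0

theorem norm_liftKernel_le {K : Vert Γ → Vert Γ → ℂ} (hK : ∀ a b, ‖K a b‖ ≤ 1) (x y : X) :
    ‖liftKernel Γ K x y‖ ≤ 1 := by
  classical
  unfold liftKernel
  split_ifs
  · rw [norm_mul, norm_inv, Complex.norm_natCast]
    exact mul_le_one₀ (Nat.cast_inv_le_one _) (norm_nonneg _) (hK _ _)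
  · simp

variable [Fintype (Vert Γ)]

/-- Levels of an invariant kernel, counted in the quotient: where the quotient looks like the
tree, each entry of a matrix on the quotient is counted at most once. -/
theorem sum_mass_norm_sq_le (hT : T.IsTree) (hreg : T.IsRegularOfDegree (q + 1))
    (hfree : ActsFreely Γ) (R : ℕ) {B : ℝ} (E : Vert Γ → Vert Γ → ℂ)
    (hE : ∀ a b, ‖E a b‖ ≤ B) :
    ∑ j ∈ Finset.range (R + 1), mass Γ j (fun x y => ‖E (proj Γ x) (proj Γ y)‖ ^ 2) ≤
      ∑ a, ∑ b, ‖E a b‖ ^ 2 +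
        Set.ncard {a : Vert Γ | injRadius Γ a < (R + 1 : ℕ)} *
          (B ^ 2 * ∑ j ∈ Finset.range (R + 1), (sphereCard q j : ℝ)) := by
  classical
  have hc := hT.connected
  set S : ℝ := B ^ 2 * ∑ j ∈ Finset.range (R + 1), (sphereCard q j : ℝ) with hS
  have hS0 : 0 ≤ S := by positivity
  have key : ∀ a : Vert Γ, ∑ j ∈ Finset.range (R + 1), ∑ y ∈ sphere T (rep Γ a) j,
      ‖E a (proj Γ y)‖ ^ 2 ≤
      ∑ b, ‖E a b‖ ^ 2 + if injRadius Γ a < (R + 1 : ℕ) then S else 0 := by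
    intro a
    split_ifs with h
    · refine le_add_of_nonneg_of_le (by positivity) ?_
      rw [hS, Finset.mul_sum]
      refine Finset.sum_le_sum fun j _ => ?_
      rw [← card_sphere hT hreg (rep Γ a) j, mul_comm, ← nsmul_eq_mul, ← Finset.sum_const]
      exact Finset.sum_le_sum fun y _ => pow_le_pow_left₀ (norm_nonneg _) (hE _ _) 2
    · obtain ⟨r, hr, hb⟩ := exists_ballIsTree_of_le_injRadius (not_lt.1 h)
      rw [add_zero, ← Finset.sum_biUnion (fun i _ j _ hij => ?_)]
      · rw [← Finset.sum_image (f := fun b => ‖E a b‖ ^ 2) (g := proj Γ)]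
        · exact Finset.sum_le_sum_of_subset_of_nonneg (Finset.subset_univ _)
            fun _ _ _ => by positivity
        · have hmem : ∀ y ∈ ((Finset.range (R + 1)).biUnion (sphere T (rep Γ a)) : Set X),
              T.dist (rep Γ a) y ≤ r := fun y hy => by
            simp only [Finset.coe_biUnion, Set.mem_iUnion, Finset.mem_coe, Finset.mem_range,
              mem_sphere hc] at hy
            obtain ⟨j, hj, hjy⟩ := hy
            omega
          rw [← proj_rep Γ a] at hb
          intro y hy y' hy' hyy'
          exact hb.proj_injOn hT hfree (hmem y hy) (hmem y' hy') hyy'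
      · refine Finset.disjoint_left.2 fun y hy hy' => hij ?_
        rw [mem_sphere hc] at hy hy'
        exact hy.symm.trans hy'
  have hcard : (Set.ncard {a : Vert Γ | injRadius Γ a < (R + 1 : ℕ)} : ℝ) * S =
      ∑ a : Vert Γ, if injRadius Γ a < (R + 1 : ℕ) then S else 0 := by
    rw [← Finset.sum_filter, Finset.sum_const, nsmul_eq_mul]
    congr 2
    rw [Set.ncard_eq_toFinset_card' ]
    congr 1
    ext a
    simp
  rw [hcard, ← Finset.sum_add_distrib]
  refine le_trans (le_of_eq ?_) (Finset.sum_le_sum fun a _ => key a)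
  unfold mass
  rw [Finset.sum_comm]
  simp only [proj_rep]

/-- Summing the lifted kernel over a level gives back the matrix. -/
theorem mass_liftKernel_mul (hT : T.IsTree) (K f : Vert Γ → Vert Γ → ℂ) (k : ℕ) :
    mass Γ k (fun x y => liftKernel Γ K x y * f (proj Γ x) (proj Γ y)) =
      ∑ a, ∑ b, if qdist Γ a b = k then K a b * f a b else 0 := by
  classical
  have hc := hT.connected
  refine Finset.sum_congr rfl fun a _ => ?_
  rw [← Finset.sum_fiberwise (sphere T (rep Γ a) k) (proj Γ)]
  refine Finset.sum_congr rfl fun b _ => ?_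
  have h1 : ∀ y ∈ ({y ∈ sphere T (rep Γ a) k | proj Γ y = b} : Finset X),
      liftKernel Γ K (rep Γ a) y * f (proj Γ (rep Γ a)) (proj Γ y) =
        (#{y ∈ sphere T (rep Γ a) k | proj Γ y = b} : ℂ)⁻¹ *
          if qdist Γ a b = k then K a b * f a b else 0 := by
    intro y hy
    rw [Finset.mem_filter, mem_sphere hc] at hy
    unfold liftKernel
    rw [hy.1, hy.2, proj_rep]
    by_cases h : qdist Γ a b = k
    · rw [if_pos h, if_pos h.symm, mul_assoc]
    · rw [if_neg h, if_neg (Ne.symm h), mul_zero, zero_mul]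
  rw [Finset.sum_congr rfl h1, Finset.sum_const, nsmul_eq_mul, ← mul_assoc]
  split_ifs with h
  · rw [mul_inv_cancel₀, one_mul]
    obtain ⟨y, hy, hd⟩ := exists_dist_eq_qdist (Γ := Γ) hc (rep Γ a) b
    rw [proj_rep, h] at hd
    rw [Nat.cast_ne_zero, Finset.card_ne_zero]
    exact ⟨y, Finset.mem_filter.2 ⟨(mem_sphere hc).2 hd, hy⟩⟩
  · simp

/-- The mean of the lifted kernel over the pairs at distance `k`. -/
def levelMean (Γ : Subgroup (T ≃g T)) [Fintype (Vert Γ)] (q : ℕ) (K : Vert Γ → Vert Γ → ℂ)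
    (k : ℕ) : ℂ :=
  ((Fintype.card (Vert Γ) : ℂ) * sphereCard q k)⁻¹ * mass Γ k (liftKernel Γ K)

/-- The lifted kernel at level `k`, with its mean subtracted. -/
def centeredLift (Γ : Subgroup (T ≃g T)) [Fintype (Vert Γ)] (q : ℕ) (K : Vert Γ → Vert Γ → ℂ)
    (k : ℕ) (x y : X) : ℂ :=
  liftKernel Γ K x y - levelMean Γ q K k

theorem card_mul_sphereCard_mul_levelMean (hq : 2 ≤ q) (hT : T.Connected)
    (K : Vert Γ → Vert Γ → ℂ) (k : ℕ) :
    (Fintype.card (Vert Γ) : ℂ) * sphereCard q k * levelMean Γ q K k =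
      mass Γ k (liftKernel Γ K) := by
  have h := (card_mul_sphereCard_pos (Γ := Γ) hq hT k).ne'
  exact mul_inv_cancel_left₀ (by exact_mod_cast h) _

theorem mass_centeredLift (hq : 2 ≤ q) (hT : T.IsTree) (hreg : T.IsRegularOfDegree (q + 1))
    (K : Vert Γ → Vert Γ → ℂ) (k : ℕ) : mass Γ k (centeredLift Γ q K k) = 0 := by
  unfold centeredLift
  rw [mass_sub, mass_const hT hreg, card_mul_sphereCard_mul_levelMean hq hT.connected, sub_self]

theorem norm_centeredLift_le (hq : 2 ≤ q) (hT : T.IsTree) (hreg : T.IsRegularOfDegree (q + 1))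
    {K : Vert Γ → Vert Γ → ℂ} (hK : ∀ a b, ‖K a b‖ ≤ 1) (k : ℕ) (x y : X) :
    ‖centeredLift Γ q K k x y‖ ≤ 2 := by
  have h0 := card_mul_sphereCard_pos (Γ := Γ) hq hT.connected k
  have h1 : ‖mass Γ k (liftKernel Γ K)‖ ≤ (Fintype.card (Vert Γ) : ℝ) * sphereCard q k := by
    refine (norm_mass_le _ _).trans ?_
    refine (mass_mono hT.connected fun x y _ => norm_liftKernel_le hK x y).trans_eq ?_
    rw [mass_const hT hreg, mul_one]
  have h2 : ‖levelMean Γ q K k‖ ≤ 1 := by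
    unfold levelMean
    rw [norm_mul, norm_inv, norm_mul, Complex.norm_natCast, Complex.norm_natCast,
      inv_mul_le_iff₀ h0, mul_one]
    exact h1
  have := norm_sub_le (liftKernel Γ K x y) (levelMean Γ q K k)
  have := norm_liftKernel_le hK x y
  unfold centeredLift
  linarith

end Lift

section Variance

variable {X : Type*} {T : SimpleGraph X} [T.LocallyFinite] {q : ℕ}
variable {Γ : Subgroup (T ≃g T)} [Fintype (Vert Γ)] {ι : Type*} [Fintype ι]

/-! ### The diagonal part of an observable -/

/-- The matrix of the operator that is diagonal in the basis `ψ` with the entries `e`. -/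
def diagKernel {V : Type*} [Fintype V] (ψ : OrthonormalBasis ι ℂ (EuclideanSpace ℂ V)) (e : ι → ℂ)
    (a b : V) : ℂ :=
  ∑ j, e j * ψ j a * (starRingEnd ℂ) (ψ j b)

theorem sum_norm_sq_eigenbasis {V : Type*} [Fintype V]
    (ψ : OrthonormalBasis ι ℂ (EuclideanSpace ℂ V)) (a : V) : ∑ j, ‖ψ j a‖ ^ 2 = 1 := by
  classical
  have h := ψ.sum_sq_norm_inner_right (EuclideanSpace.basisFun V ℂ a)
  rw [(EuclideanSpace.basisFun V ℂ).norm_eq_one, one_pow] at h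
  rw [← h]
  refine Finset.sum_congr rfl fun j _ => ?_
  rw [← inner_conj_symm, Complex.norm_conj, EuclideanSpace.basisFun_inner]

theorem norm_diagKernel_le {V : Type*} [Fintype V]
    (ψ : OrthonormalBasis ι ℂ (EuclideanSpace ℂ V)) {e : ι → ℂ} {B : ℝ}
    (he : ∀ j, ‖e j‖ ≤ B) (a b : V) : ‖diagKernel ψ e a b‖ ≤ B := by
  calc ‖diagKernel ψ e a b‖ ≤ ∑ j, B / 2 * (‖ψ j a‖ ^ 2 + ‖ψ j b‖ ^ 2) := by
        refine (norm_sum_le _ _).trans (Finset.sum_le_sum fun j _ => ?_)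
        rw [norm_mul, norm_mul, Complex.norm_conj, mul_assoc]
        have h1 : 0 ≤ ‖ψ j a‖ * ‖ψ j b‖ := by positivity
        have h2 := mul_le_mul_of_nonneg_right (he j) h1
        have h3 : 0 ≤ B := (norm_nonneg _).trans (he j)
        nlinarith [mul_nonneg h3 (sq_nonneg (‖ψ j a‖ - ‖ψ j b‖))]
    _ = B := by
        rw [← Finset.mul_sum, Finset.sum_add_distrib, sum_norm_sq_eigenbasis,
          sum_norm_sq_eigenbasis]
        ring

/-- The Hilbert–Schmidt norm of a diagonal operator. -/
theorem sum_norm_sq_diagKernel {V : Type*} [Fintype V]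
    (ψ : OrthonormalBasis ι ℂ (EuclideanSpace ℂ V)) (e : ι → ℂ) :
    ∑ a, ∑ b, ‖diagKernel ψ e a b‖ ^ 2 = ∑ j, ‖e j‖ ^ 2 := by
  classical
  have hrow : ∀ a, ∑ b, ‖diagKernel ψ e a b‖ ^ 2 = ∑ j, ‖e j‖ ^ 2 * ‖ψ j a‖ ^ 2 := by
    intro a
    set c : EuclideanSpace ℂ ι := WithLp.toLp 2 fun j => (starRingEnd ℂ) (e j * ψ j a) with hc
    have h1 : ‖ψ.repr.symm c‖ ^ 2 = ‖c‖ ^ 2 := by rw [LinearIsometryEquiv.norm_map]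
    rw [EuclideanSpace.norm_sq_eq, EuclideanSpace.norm_sq_eq] at h1
    have h2 : ∀ b, ‖diagKernel ψ e a b‖ = ‖ψ.repr.symm c b‖ := by
      intro b
      rw [← ψ.sum_repr_symm, ← Complex.norm_conj, diagKernel, map_sum]
      simp [hc]
    simp only [h2, h1]
    refine Finset.sum_congr rfl fun j _ => ?_
    rw [hc, ← mul_pow, ← norm_mul]
    simp
  simp only [hrow]
  rw [Finset.sum_comm]
  refine Finset.sum_congr rfl fun j _ => ?_
  rw [← Finset.mul_sum, ← EuclideanSpace.norm_sq_eq, ψ.norm_eq_one, one_pow, mul_one]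

/-- An operator that is diagonal in an eigenbasis commutes with the adjacency operator, and this
is inherited by its lift to the tree. -/
theorem sum_neighborFinset_diagKernel {lam : ι → ℝ}
    {ψ : OrthonormalBasis ι ℂ (EuclideanSpace ℂ (Vert Γ))}
    (hψ : ∀ j, adjOp Γ (ψ j) = (lam j : ℂ) • ψ j) (e : ι → ℂ) (x y : X) :
    ∑ z ∈ T.neighborFinset x, diagKernel ψ e (proj Γ z) (proj Γ y) =
      ∑ z ∈ T.neighborFinset y, diagKernel ψ e (proj Γ x) (proj Γ z) := by
  unfold diagKernel
  rw [Finset.sum_comm, Finset.sum_comm (s := T.neighborFinset y)]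
  refine Finset.sum_congr rfl fun j _ => ?_
  rw [← Finset.sum_mul, ← Finset.mul_sum, ← Finset.mul_sum, ← map_sum,
    sum_neighborFinset_eigenvector (hψ j), sum_neighborFinset_eigenvector (hψ j), map_mul,
    Complex.conj_ofReal]
  ring

theorem inner_apply_eq_sum_kernel {V : Type*} [Fintype V]
    (K : EuclideanSpace ℂ V →ₗ[ℂ] EuclideanSpace ℂ V) (f : EuclideanSpace ℂ V) :
    inner ℂ f (K f) = ∑ a, ∑ b, kernel K a b * ((starRingEnd ℂ) (f a) * f b) := by
  classical
  have h1 : K f = ∑ b, f b • K (EuclideanSpace.basisFun V ℂ b) := by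
    conv_lhs => rw [← (EuclideanSpace.basisFun V ℂ).sum_repr f]
    rw [map_sum]
    refine Finset.sum_congr rfl fun b _ => ?_
    rw [map_smul, EuclideanSpace.basisFun_repr]
  rw [PiLp.inner_apply]
  refine Finset.sum_congr rfl fun a _ => ?_
  rw [h1]
  simp only [WithLp.ofLp_sum, WithLp.ofLp_smul, Finset.sum_apply, Pi.smul_apply, inner_sum,
    kernel, EuclideanSpace.basisFun_inner]
  refine Finset.sum_congr rfl fun b _ => ?_
  simp only [RCLike.inner_apply, smul_eq_mul]
  ring

/-- The diagonal matrix elements, with their predicted means subtracted, in terms of the centered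
lift of the observable. -/
theorem inner_sub_sphericalMean (hq : 2 ≤ q) (hT : T.IsTree)
    (hreg : T.IsRegularOfDegree (q + 1)) {l : ℝ} {f : EuclideanSpace ℂ (Vert Γ)}
    (hf : adjOp Γ f = (l : ℂ) • f) (hnorm : ‖f‖ = 1) (D : ℕ)
    (K : EuclideanSpace ℂ (Vert Γ) →ₗ[ℂ] EuclideanSpace ℂ (Vert Γ))
    (hK : ∀ a b, D < qdist Γ a b → kernel K a b = 0) :
    inner ℂ f (K f) - sphericalMean q Γ K l =
      ∑ k ∈ Finset.range (D + 1), mass Γ k fun x y =>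
        centeredLift Γ q (kernel K) k x y * ((starRingEnd ℂ) (f (proj Γ x)) * f (proj Γ y)) := by
  have hsplit : ∀ g : Vert Γ → Vert Γ → ℂ, ∑ a, ∑ b, kernel K a b * g a b =
      ∑ k ∈ Finset.range (D + 1), mass Γ k fun x y =>
        liftKernel Γ (kernel K) x y * g (proj Γ x) (proj Γ y) := by
    intro g
    simp only [mass_liftKernel_mul hT]
    symm
    rw [Finset.sum_comm]
    refine Finset.sum_congr rfl fun a _ => ?_
    rw [Finset.sum_comm]
    refine Finset.sum_congr rfl fun b _ => ?_
    rw [Finset.sum_ite_eq]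
    split_ifs with h
    · rfl
    · rw [hK a b (by simpa using h), zero_mul]
  have hmean : sphericalMean q Γ K l = ∑ k ∈ Finset.range (D + 1),
      levelMean Γ q (kernel K) k * (sphereCard q k * spherical q l k) := by
    rw [sphericalMean, hsplit fun a b => spherical q l (qdist Γ a b), Finset.mul_sum]
    refine Finset.sum_congr rfl fun k _ => ?_
    have h1 : mass Γ k (fun x y => liftKernel Γ (kernel K) x y *
        spherical q l (qdist Γ (proj Γ x) (proj Γ y))) =
        spherical q l k * mass Γ k (liftKernel Γ (kernel K)) := by
      rw [← mass_mul_left]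
      refine mass_congr hT.connected fun x y hxy => ?_
      unfold liftKernel
      split_ifs with h
      · rw [← h, hxy, mul_comm]
      · simp
    have h2 := card_mul_sphereCard_mul_levelMean (Γ := Γ) hq hT.connected (kernel K) k
    have h3 : (Fintype.card (Vert Γ) : ℂ) ≠ 0 := by
      exact_mod_cast (card_vert_pos hT.connected).ne'
    rw [h1, ← h2]
    field_simp
  have hsphere : ∀ k, mass Γ k (fun x y => (starRingEnd ℂ) (f (proj Γ x)) * f (proj Γ y)) =
      sphereCard q k * spherical q l k := by
    intro k
    unfold mass
    simp only [← Finset.mul_sum]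
    have h1 : ∀ a, ∑ y ∈ sphere T (rep Γ a) k, f (proj Γ y) =
        sphereCard q k * spherical q l k * f a := fun a => by
      rw [sum_sphere_eigenfunction hq hT hreg (f := fun x => f (proj Γ x))
        (sum_neighborFinset_eigenvector hf), proj_rep]
    simp only [h1, proj_rep]
    have h2 : ∑ a, (starRingEnd ℂ) (f a) * f a = 1 := by
      have h3 := EuclideanSpace.norm_sq_eq f
      rw [hnorm, one_pow] at h3
      simp only [Complex.conj_mul']
      exact_mod_cast h3.symm
    calc _ = sphereCard q k * spherical q l k * ∑ a, (starRingEnd ℂ) (f a) * f a := by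
          rw [Finset.mul_sum]
          exact Finset.sum_congr rfl fun a _ => by ring
      _ = _ := by rw [h2, mul_one]
  rw [inner_apply_eq_sum_kernel, hsplit fun a b => (starRingEnd ℂ) (f a) * f b, hmean,
    ← Finset.sum_sub_distrib]
  refine Finset.sum_congr rfl fun k _ => ?_
  rw [← hsphere, ← mass_mul_left, ← mass_sub]
  refine mass_congr hT.connected fun x y _ => ?_
  unfold centeredLift
  ring

/-- The number of vertices in a ball of radius `D` in the tree. -/
def ballCard (q D : ℕ) : ℝ := ∑ k ∈ Finset.range (D + 1), (sphereCard q k : ℝ)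

theorem ballCard_nonneg (q D : ℕ) : 0 ≤ ballCard q D := by unfold ballCard; positivity

/-- A bound for the diagonal matrix elements that does not depend on the quotient. -/
theorem norm_inner_sub_sphericalMean_le (hq : 2 ≤ q) (hT : T.IsTree)
    (hreg : T.IsRegularOfDegree (q + 1)) (hfree : ActsFreely Γ) {l : ℝ}
    {f : EuclideanSpace ℂ (Vert Γ)}
    (hf : adjOp Γ f = (l : ℂ) • f) (hnorm : ‖f‖ = 1) (D : ℕ)
    (K : EuclideanSpace ℂ (Vert Γ) →ₗ[ℂ] EuclideanSpace ℂ (Vert Γ))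
    (hK : ∀ a b, D < qdist Γ a b → kernel K a b = 0) (hK1 : ∀ a b, ‖kernel K a b‖ ≤ 1) :
    ‖inner ℂ f (K f) - sphericalMean q Γ K l‖ ≤ 2 * ballCard q D := by
  rw [inner_sub_sphericalMean hq hT hreg hf hnorm D K hK, ballCard, Finset.mul_sum]
  refine (norm_sum_le _ _).trans (Finset.sum_le_sum fun k _ => ?_)
  have h1 : ∑ a, ‖f a‖ ^ 2 = 1 := by rw [← EuclideanSpace.norm_sq_eq, hnorm, one_pow]
  calc _ ≤ mass Γ k fun x y => ‖f (proj Γ x)‖ ^ 2 + ‖f (proj Γ y)‖ ^ 2 := by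
        refine (norm_mass_le _ _).trans (mass_mono hT.connected fun x y _ => ?_)
        rw [norm_mul, norm_mul, Complex.norm_conj]
        have h2 := norm_centeredLift_le hq hT hreg hK1 k x y
        have h3 : 0 ≤ ‖f (proj Γ x)‖ * ‖f (proj Γ y)‖ := by positivity
        nlinarith [mul_le_mul_of_nonneg_right h2 h3, sq_nonneg (‖f (proj Γ x)‖ - ‖f (proj Γ y)‖)]
    _ = 2 * sphereCard q k := by
        rw [mass_add, mass_proj_left hT hreg k fun a => ‖f a‖ ^ 2,
          mass_proj_right hT hreg hfree k fun a => ‖f a‖ ^ 2, h1]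
        ring

/-! ### The quantum variance -/

/-- The quantum variance of an observable is its pairing with its own diagonal part, from which
constants may be subtracted at every level. -/
theorem sum_norm_sq_eq_pairing (hq : 2 ≤ q) (hT : T.IsTree)
    (hreg : T.IsRegularOfDegree (q + 1)) {lam : ι → ℝ}
    {ψ : OrthonormalBasis ι ℂ (EuclideanSpace ℂ (Vert Γ))}
    (hψ : ∀ j, adjOp Γ (ψ j) = (lam j : ℂ) • ψ j) (D : ℕ)
    (K : EuclideanSpace ℂ (Vert Γ) →ₗ[ℂ] EuclideanSpace ℂ (Vert Γ))
    (hK : ∀ a b, D < qdist Γ a b → kernel K a b = 0) {e : ι → ℂ}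
    (he : ∀ j, e j = inner ℂ (ψ j) (K (ψ j)) - sphericalMean q Γ K (lam j)) (c : ℕ → ℂ) :
    ((∑ j, ‖e j‖ ^ 2 : ℝ) : ℂ) =
      ∑ k ∈ Finset.range (D + 1), mass Γ k fun x y => centeredLift Γ q (kernel K) k x y *
        (starRingEnd ℂ) (diagKernel ψ e (proj Γ x) (proj Γ y) - c k) := by
  have h1 : ((∑ j, ‖e j‖ ^ 2 : ℝ) : ℂ) = ∑ j, (starRingEnd ℂ) (e j) *
      ∑ k ∈ Finset.range (D + 1), mass Γ k fun x y => centeredLift Γ q (kernel K) k x y *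
        ((starRingEnd ℂ) (ψ j (proj Γ x)) * ψ j (proj Γ y)) := by
    push_cast
    refine Finset.sum_congr rfl fun j _ => ?_
    rw [← inner_sub_sphericalMean hq hT hreg (hψ j) (ψ.norm_eq_one j) D K hK, ← he,
      Complex.conj_mul']
  rw [h1]
  simp only [Finset.mul_sum]
  rw [Finset.sum_comm]
  refine Finset.sum_congr rfl fun k _ => ?_
  have h2 : mass Γ k (fun x y => centeredLift Γ q (kernel K) k x y *
      (starRingEnd ℂ) (diagKernel ψ e (proj Γ x) (proj Γ y) - c k)) =
      mass Γ k (fun x y => centeredLift Γ q (kernel K) k x y *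
        (starRingEnd ℂ) (diagKernel ψ e (proj Γ x) (proj Γ y))) := by
    have h3 := mass_mul_left (Γ := Γ) k ((starRingEnd ℂ) (c k)) (centeredLift Γ q (kernel K) k)
    rw [mass_centeredLift hq hT hreg, mul_zero] at h3
    rw [← sub_zero (mass Γ k fun x y => centeredLift Γ q (kernel K) k x y *
        (starRingEnd ℂ) (diagKernel ψ e (proj Γ x) (proj Γ y))), ← h3, ← mass_sub]
    refine mass_congr hT.connected fun x y _ => ?_
    rw [map_sub]
    ring
  rw [h2]
  simp only [mass, Finset.mul_sum]
  rw [Finset.sum_comm]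
  refine Finset.sum_congr rfl fun a _ => ?_
  rw [Finset.sum_comm]
  refine Finset.sum_congr rfl fun y _ => ?_
  rw [diagKernel, map_sum, Finset.mul_sum]
  refine Finset.sum_congr rfl fun j _ => ?_
  simp only [map_mul, Complex.conj_conj]
  ring

/-- A bound for the quantum variance in terms of the free parameters `s`, `t`, `U` and of the
proportion of vertices with a small injectivity radius. -/
theorem quantumVariance_le (hq : 2 ≤ q) (hT : T.IsTree) (hreg : T.IsRegularOfDegree (q + 1))
    (hfree : ActsFreely Γ) {lam : ι → ℝ} {ψ : OrthonormalBasis ι ℂ (EuclideanSpace ℂ (Vert Γ))}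
    (hψ : ∀ j, adjOp Γ (ψ j) = (lam j : ℂ) • ψ j) {κ : ℝ} (hκ : 0 < κ)
    (hgap : ∀ g : Vert Γ → ℂ, ∃ c : ℂ, κ * ∑ a, ‖g a - c‖ ^ 2 ≤
      mass Γ 1 fun x y => ‖g (proj Γ y) - g (proj Γ x)‖ ^ 2) (D : ℕ)
    (K : EuclideanSpace ℂ (Vert Γ) →ₗ[ℂ] EuclideanSpace ℂ (Vert Γ))
    (hK : ∀ a b, D < qdist Γ a b → kernel K a b = 0) (hK1 : ∀ a b, ‖kernel K a b‖ ≤ 1)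
    {s t : ℝ} (hs : 0 < s) (ht : 0 < t) {U : ℕ} (hU : 0 < U) :
    (1 / (Fintype.card (Vert Γ) : ℝ)) *
        ∑ j, ‖inner ℂ (ψ j) (K (ψ j)) - sphericalMean q Γ K (lam j)‖ ^ 2 ≤
      s * ballCard q D + s⁻¹ * (t * ∑ k ∈ Finset.range (D + 1),
          gapConst q κ k * ((2 * ballCard q D) ^ 2 * sphereCard q k) +
        t⁻¹ * (∑ k ∈ Finset.range (D + 1),
          gapConst q κ k * (32 * (q + 1) ^ 2 * (2 * ballCard q D) ^ 2)) * (U : ℝ)⁻¹ *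
          (1 + Set.ncard {a : Vert Γ | injRadius Γ a < (D + 2 * U + 1 : ℕ)} /
            Fintype.card (Vert Γ) * ballCard q (D + 2 * U))) := by
  classical
  set N : ℝ := (Fintype.card (Vert Γ) : ℝ) with hN
  have hN0 : 0 < N := by rw [hN]; exact_mod_cast card_vert_pos (Γ := Γ) hT.connected
  have hcardι : (Fintype.card ι : ℝ) = N := by
    have h1 := Module.finrank_eq_card_basis ψ.toBasis
    rw [finrank_euclideanSpace] at h1
    rw [hN, h1]
  have hU0 : (0 : ℝ) < U := by exact_mod_cast hU
  set B : ℝ := 2 * ballCard q D with hB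
  set bad : ℝ := (Set.ncard {a : Vert Γ | injRadius Γ a < (D + 2 * U + 1 : ℕ)} : ℝ) with hbad
  set e : ι → ℂ := fun j => inner ℂ (ψ j) (K (ψ j)) - sphericalMean q Γ K (lam j) with he
  have heB : ∀ j, ‖e j‖ ≤ B := fun j =>
    norm_inner_sub_sphericalMean_le hq hT hreg hfree (hψ j) (ψ.norm_eq_one j) D K hK hK1
  set E : X → X → ℂ := fun x y => diagKernel ψ e (proj Γ x) (proj Γ y) with hE
  have hEinv : IsInvariant Γ E := isInvariant_proj (diagKernel ψ e)
  have hEcomm := sum_neighborFinset_diagKernel hψ e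
  have hvar : ∑ j, ‖e j‖ ^ 2 ≤ B ^ 2 * N := by
    rw [← hcardι, mul_comm, ← nsmul_eq_mul, ← Finset.card_univ, ← Finset.sum_const]
    exact Finset.sum_le_sum fun j _ => pow_le_pow_left₀ (norm_nonneg _) (heB j) 2
  have hlevels : ∑ j ∈ Finset.range (D + 2 * U + 1), mass Γ j (fun x y => ‖E x y‖ ^ 2) ≤
      B ^ 2 * N * (1 + bad / N * ballCard q (D + 2 * U)) := by
    have h1 := sum_mass_norm_sq_le hT hreg hfree (D + 2 * U) (diagKernel ψ e)
      (norm_diagKernel_le ψ heB)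
    rw [sum_norm_sq_diagKernel] at h1
    refine h1.trans ((add_le_add_left hvar _).trans_eq ?_)
    rw [← hbad, ballCard]
    field_simp
  choose c hc using fun k => exists_mass_norm_sq_sub_const_le hq hT hreg hfree hκ hgap k hEinv
  have hlevel : ∀ k ∈ Finset.range (D + 1), mass Γ k (fun x y => ‖E x y - c k‖ ^ 2) ≤
      gapConst q κ k * (t * (B ^ 2 * (N * sphereCard q k)) + t⁻¹ * ((U : ℝ)⁻¹ *
        (32 * (q + 1) ^ 2 * (B ^ 2 * N * (1 + bad / N * ballCard q (D + 2 * U)))))) := by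
    intro k hk
    rw [Finset.mem_range] at hk
    refine (hc k).trans (mul_le_mul_of_nonneg_left ?_ (gapConst_pos q hκ k).le)
    refine (mass_norm_sq_inC_le hT hfree hEinv hEcomm k ht).trans (add_le_add ?_ ?_)
    · refine mul_le_mul_of_nonneg_left ?_ ht.le
      refine (mass_mono hT.connected (G := fun _ _ => B ^ 2) fun x y _ =>
        pow_le_pow_left₀ (norm_nonneg _) (norm_diagKernel_le ψ heB _ _) 2).trans_eq ?_
      rw [mass_const hT hreg, mul_comm]
    · refine mul_le_mul_of_nonneg_left ?_ (inv_nonneg.2 ht.le)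
      rw [← div_eq_inv_mul, le_div_iff₀' hU0]
      refine (mul_mass_norm_sq_outC_outC_le hq hT hreg hfree hEinv hEcomm
        (R := D + 2 * U + 1) (by omega)).trans ?_
      exact mul_le_mul_of_nonneg_left hlevels (by positivity)
  have hpair : ∑ j, ‖e j‖ ^ 2 ≤ ∑ k ∈ Finset.range (D + 1),
      (s * (N * sphereCard q k) + s⁻¹ * mass Γ k fun x y => ‖E x y - c k‖ ^ 2) := by
    have h1 := sum_norm_sq_eq_pairing hq hT hreg hψ D K hK (e := e) (fun _ => rfl) c
    have h2 : ∑ j, ‖e j‖ ^ 2 = ‖((∑ j, ‖e j‖ ^ 2 : ℝ) : ℂ)‖ := by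
      rw [Complex.norm_real, Real.norm_of_nonneg (by positivity)]
    rw [h2, h1]
    refine (norm_sum_le _ _).trans (Finset.sum_le_sum fun k _ => (norm_mass_le _ _).trans ?_)
    have h3 : s * (N * sphereCard q k) = mass Γ k fun _ _ => s := by
      rw [mass_const hT hreg, mul_comm]
    rw [h3, ← mass_mul_left, ← mass_add]
    refine mass_mono hT.connected fun x y _ => ?_
    rw [norm_mul, Complex.norm_conj]
    have h4 := norm_centeredLift_le hq hT hreg hK1 k x y
    have h5 : s⁻¹ * (s - ‖E x y - c k‖) ^ 2 =
        s + s⁻¹ * ‖E x y - c k‖ ^ 2 - 2 * ‖E x y - c k‖ := by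
      field_simp
      ring
    have h6 : 0 ≤ s⁻¹ * (s - ‖E x y - c k‖) ^ 2 := by positivity
    have h7 := mul_le_mul_of_nonneg_right h4 (norm_nonneg (E x y - c k))
    linarith
  have hsum : ∑ j, ‖e j‖ ^ 2 ≤ ∑ k ∈ Finset.range (D + 1),
      (s * (N * sphereCard q k) + s⁻¹ * (gapConst q κ k * (t * (B ^ 2 * (N * sphereCard q k)) +
        t⁻¹ * ((U : ℝ)⁻¹ *
          (32 * (q + 1) ^ 2 * (B ^ 2 * N * (1 + bad / N * ballCard q (D + 2 * U)))))))) :=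
    hpair.trans (Finset.sum_le_sum fun k hk => (add_le_add_iff_left _).2
      (mul_le_mul_of_nonneg_left (hlevel k hk) (inv_nonneg.2 hs.le)))
  rw [one_div, inv_mul_le_iff₀ hN0]
  refine hsum.trans_eq ?_
  generalize bad / N * ballCard q (D + 2 * U) = w
  rw [ballCard]
  simp only [mul_add, Finset.sum_add_distrib, Finset.mul_sum, Finset.sum_mul]
  congr 1
  · exact Finset.sum_congr rfl fun k _ => by ring
  congr 1
  · exact Finset.sum_congr rfl fun k _ => by ring
  · rw [← Finset.sum_add_distrib, ← Finset.sum_add_distrib]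
    exact Finset.sum_congr rfl fun k _ => by ring

end Variance

end

end QuantumErgodicity


theorem theorem1p2 (q : ℕ) (hq : 2 ≤ q)
    {X : Type*} (T : SimpleGraph X) [T.LocallyFinite]
    (hT : T.IsTree) (hreg : T.IsRegularOfDegree (q + 1))
    (Γ : ℕ → Subgroup (T ≃g T)) (hfree : ∀ n, QuantumErgodicity.ActsFreely (Γ n))
    [∀ n, Fintype (QuantumErgodicity.Vert (Γ n))]
    (hcard : Tendsto (fun n => Fintype.card (QuantumErgodicity.Vert (Γ n))) atTop atTop)
    (hEXP : QuantumErgodicity.EXP q Γ) (hBST : QuantumErgodicity.BST Γ)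
    (lam : ∀ n, Fin (Fintype.card (QuantumErgodicity.Vert (Γ n))) → ℝ)
    (ψ : ∀ n, OrthonormalBasis (Fin (Fintype.card (QuantumErgodicity.Vert (Γ n)))) ℂ
      (EuclideanSpace ℂ (QuantumErgodicity.Vert (Γ n))))
    (hψ : ∀ n j, QuantumErgodicity.adjOp (Γ n) (ψ n j) = (lam n j : ℂ) • ψ n j)
    (D : ℕ)
    (K : ∀ n, EuclideanSpace ℂ (QuantumErgodicity.Vert (Γ n)) →ₗ[ℂ]
      EuclideanSpace ℂ (QuantumErgodicity.Vert (Γ n)))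
    (hKsupp : ∀ n a b, D < QuantumErgodicity.qdist (Γ n) a b →
      QuantumErgodicity.kernel (K n) a b = 0)
    (hKbound : ∀ n a b, ‖QuantumErgodicity.kernel (K n) a b‖ ≤ 1) :
    Tendsto (fun n => (1 / (Fintype.card (QuantumErgodicity.Vert (Γ n)) : ℝ)) *
        ∑ j, ‖inner ℂ (ψ n j) (K n (ψ n j)) -
          QuantumErgodicity.sphericalMean q (Γ n) (K n) (lam n j)‖ ^ 2)
      atTop (𝓝 0) := by
  open QuantumErgodicity in
  obtain ⟨β, hβ, hspec⟩ := hEXP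
  set κ : ℝ := 2 * (q + 1) * β with hκdef
  have hκ : 0 < κ := by positivity
  have hgap := fun n => exists_gap hT hreg (hfree n) (hψ n) (β := β) fun j =>
    eigenvalue_le_of_spectrum (hspec n) ((ψ n).orthonormal.ne_zero j) (hψ n j)
  set C₁ : ℝ := ballCard q D with hC₁
  set C₂ : ℝ := ∑ k ∈ Finset.range (D + 1),
    gapConst q κ k * ((2 * ballCard q D) ^ 2 * sphereCard q k) with hC₂
  set C₃ : ℝ := ∑ k ∈ Finset.range (D + 1),
    gapConst q κ k * (32 * (q + 1) ^ 2 * (2 * ballCard q D) ^ 2) with hC₃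
  have hC₁0 : 0 ≤ C₁ := ballCard_nonneg q D
  have hC₂0 : 0 ≤ C₂ := Finset.sum_nonneg fun k _ =>
    mul_nonneg (gapConst_pos q hκ k).le (by positivity)
  have hC₃0 : 0 ≤ C₃ := Finset.sum_nonneg fun k _ =>
    mul_nonneg (gapConst_pos q hκ k).le (by positivity)
  refine tendsto_order.2 ⟨fun a ha => Filter.Eventually.of_forall fun n =>
    ha.trans_le (by positivity), fun ε hε => ?_⟩
  -- The parameters make each of the three terms of the bound at most `ε / 4`.
  set s : ℝ := ε / (4 * (C₁ + 1)) with hs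
  have hs0 : 0 < s := by positivity
  set t : ℝ := s * ε / (4 * (C₂ + 1)) with ht
  have ht0 : 0 < t := by positivity
  obtain ⟨U, hU⟩ := exists_nat_gt (8 * C₃ / (s * t * ε))
  have hU0 : (0 : ℝ) < U := lt_of_le_of_lt (by positivity) hU
  have hbad : ∀ᶠ n in atTop,
      (Set.ncard {a : Vert (Γ n) | injRadius (Γ n) a < (D + 2 * U + 1 : ℕ)} : ℝ) /
        Fintype.card (Vert (Γ n)) * ballCard q (D + 2 * U) < 1 := by
    have h1 := (hBST (D + 2 * U + 1)).mul_const (ballCard q (D + 2 * U))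
    rw [zero_mul] at h1
    exact (tendsto_order.1 h1).2 1 one_pos
  filter_upwards [hbad] with n hn
  refine (quantumVariance_le hq hT hreg (hfree n) (hψ n) hκ (hgap n) D (K n) (hKsupp n)
    (hKbound n) hs0 ht0 (U := U) (by exact_mod_cast hU0)).trans_lt ?_
  rw [← hC₁, ← hC₂, ← hC₃]
  set w : ℝ := 1 + (Set.ncard {a : Vert (Γ n) | injRadius (Γ n) a < (D + 2 * U + 1 : ℕ)} : ℝ) /
        Fintype.card (Vert (Γ n)) * ballCard q (D + 2 * U) with hw
  have hw2 : w ≤ 2 := by linarith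
  have b1 : s * C₁ ≤ ε / 4 := by
    have : s * (C₁ + 1) = ε / 4 := by rw [hs]; field_simp
    linarith
  have b2 : s⁻¹ * (t * C₂) ≤ ε / 4 := by
    have : t * (C₂ + 1) = s * (ε / 4) := by rw [ht]; field_simp
    rw [inv_mul_le_iff₀ hs0]
    linarith
  have b3 : s⁻¹ * (t⁻¹ * C₃ * (U : ℝ)⁻¹ * w) ≤ ε / 4 := by
    have h1 : 8 * C₃ ≤ U * (s * t * ε) := ((div_lt_iff₀ (by positivity)).1 hU).le
    calc s⁻¹ * (t⁻¹ * C₃ * (U : ℝ)⁻¹ * w) ≤ s⁻¹ * (t⁻¹ * C₃ * (U : ℝ)⁻¹ * 2) := by gcongr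
      _ = 8 * C₃ / (4 * (U * (s * t))) := by field_simp; ring
      _ ≤ U * (s * t * ε) / (4 * (U * (s * t))) := by gcongr
      _ = ε / 4 := by field_simp
  calc s * C₁ + s⁻¹ * (t * C₂ + t⁻¹ * C₃ * (U : ℝ)⁻¹ * w)
      = s * C₁ + s⁻¹ * (t * C₂) + s⁻¹ * (t⁻¹ * C₃ * (U : ℝ)⁻¹ * w) := by ring
    _ ≤ ε / 4 + ε / 4 + ε / 4 := add_le_add (add_le_add b1 b2) b3
    _ < ε := by linarith
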